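/- Let $\mathfrak K$ be a field, let $\Gamma$ be a finite quiver (paths are composed from right to left), let $I$ be an admissible ideal of the path algebra $\mathfrak K\Gamma$, and let $\Lambda=\mathfrak K\Gamma/I$, with Jacobson radical $J$. A module is uniserial if it has exactly one composition series (the zero module counts as uniserial). Let $m$ be a natural number and suppose that $\Lambda$ is left $m$-multiserial, i.e. for each primitive idempotent $e$ of $\Lambda$ the left ideal $Je$ is a (not necessarily direct) sum of $m$ uniserial $\Lambda$-modules. Let $U$ be a finitely generated non-projective uniserial left $\Lambda$-module of length $n$, and let $p$ be a mast of $U$, i.e. a path in $\Gamma$ of length $n-1$ such that $px\neq 0$ for some $x\in U$; let $\mathrm s(p)$ be its starting vertex. Let $\alpha(U)$ be the number of summands in a decomposition of the middle term $B$ into indecomposable modules, where $0\to A\to B\to U\to 0$ is an almost split sequence of finitely generated left $\Lambda$-modules; such a sequence exists, and the number depends only on $U$. Then: (i) if $m=1$, then $\alpha(U)\le 2$; (ii) if there is exactly one arrow of $\Gamma$ that starts at $\mathrm s(p)$, then $\alpha(U)\le 2$; (iii) if $m=2$ and $Jp=0$ in $\Lambda$, then $\alpha(U)=1$. -/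

import Mathlib

universe u

/-! ### Path algebras -/

/-- The paths of a quiver, including the trivial paths, together with their endpoints:
`⟨a, b, p⟩` is the path `p` from `a` to `b`. -/
abbrev QuiverPath (V : Type u) [Quiver.{u} V] : Type u :=
  Σ a b : V, Quiver.Path a b

/-- The path algebra of a quiver: the vector space with basis the set of all paths. -/
def PathAlgebra (K V : Type u) [Field K] [Quiver.{u} V] : Type u :=
  QuiverPath V →₀ K

namespace PathAlgebra

variable {K V : Type u} [Field K] [Quiver.{u} V]

noncomputable instance : AddCommGroup (PathAlgebra K V) :=
  inferInstanceAs (AddCommGroup (QuiverPath V →₀ K))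

noncomputable instance : Module K (PathAlgebra K V) :=
  inferInstanceAs (Module K (QuiverPath V →₀ K))

/-- The basis element of the path algebra given by a path. -/
noncomputable def single (p : QuiverPath V) : PathAlgebra K V :=
  Finsupp.single p 1

/-- The path `p`, as an element of the path algebra. -/
noncomputable def ofPath (K : Type u) [Field K] {a b : V} (p : Quiver.Path a b) :
    PathAlgebra K V :=
  single ⟨a, b, p⟩

open Classical in
/-- The product `q p` of two paths, composed from right to left: it is "first `p`, then `q`" if `p`
ends where `q` starts, and `0` otherwise. -/
noncomputable def basisMul (q p : QuiverPath V) : PathAlgebra K V :=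
  if h : q.1 = p.2.1 then ofPath K (p.2.2.comp (q.2.2.cast h rfl)) else 0

/-- The bilinear extension of the product of paths. -/
noncomputable def mulHom :
    PathAlgebra K V →ₗ[K] PathAlgebra K V →ₗ[K] PathAlgebra K V :=
  Finsupp.linearCombination K fun q : QuiverPath V =>
    (Finsupp.linearCombination K fun p : QuiverPath V => basisMul q p :
      (QuiverPath V →₀ K) →ₗ[K] PathAlgebra K V)

noncomputable instance : Mul (PathAlgebra K V) := ⟨fun x y => mulHom x y⟩

/-- The unit element is the sum of all trivial paths. -/
noncomputable instance [Fintype V] : One (PathAlgebra K V) :=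
  ⟨∑ a : V, ofPath K (Quiver.Path.nil : Quiver.Path a a)⟩

theorem mul_def (x y : PathAlgebra K V) : x * y = mulHom x y := rfl

theorem single_mul_single (q p : QuiverPath V) :
    (single q * single p : PathAlgebra K V) = basisMul q p := by
  rw [mul_def]
  unfold mulHom single
  erw [Finsupp.linearCombination_single, one_smul, Finsupp.linearCombination_single, one_smul]

theorem ofPath_mul_ofPath {a b c : V} (q : Quiver.Path b c) (p : Quiver.Path a b) :
    ofPath K q * ofPath K p = ofPath K (p.comp q) := by
  unfold ofPath
  rw [single_mul_single]
  simp [basisMul, ofPath]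

theorem ofPath_mul_ofPath_of_ne {a b c d : V} (q : Quiver.Path c d) (p : Quiver.Path a b)
    (h : c ≠ b) : ofPath K q * ofPath K p = 0 := by
  unfold ofPath
  rw [single_mul_single]
  simp [basisMul, h]

@[elab_as_elim]
theorem induction_on {P : PathAlgebra K V → Prop} (x : PathAlgebra K V) (zero : P 0)
    (add : ∀ x y, P x → P y → P (x + y)) (smul : ∀ (c : K) x, P x → P (c • x))
    (path : ∀ (a b : V) (p : Quiver.Path a b), P (ofPath K p)) : P x := by
  refine Finsupp.induction_linear (motive := P) x zero add fun p c => ?_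
  have h : (Finsupp.single p c : QuiverPath V →₀ K) = c • (Finsupp.single p 1 : QuiverPath V →₀ K) :=
    by simp
  have h2 := smul c _ (path p.1 p.2.1 p.2.2)
  rw [h]
  exact h2

protected theorem add_mul' (x y z : PathAlgebra K V) : (x + y) * z = x * z + y * z := by
  simp [mul_def]

protected theorem mul_add' (x y z : PathAlgebra K V) : x * (y + z) = x * y + x * z := by
  simp [mul_def]

protected theorem smul_mul' (c : K) (x y : PathAlgebra K V) : (c • x) * y = c • (x * y) := by
  simp [mul_def]

protected theorem mul_smul' (c : K) (x y : PathAlgebra K V) : x * (c • y) = c • (x * y) := by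
  simp [mul_def]

protected theorem zero_mul' (x : PathAlgebra K V) : 0 * x = 0 := by
  simp [mul_def]

protected theorem mul_zero' (x : PathAlgebra K V) : x * 0 = 0 := by
  simp [mul_def]

protected theorem mul_assoc' (x y z : PathAlgebra K V) : x * y * z = x * (y * z) := by
  induction x using induction_on with
  | zero => simp only [PathAlgebra.zero_mul']
  | add x x' h h' => simp only [PathAlgebra.add_mul', h, h']
  | smul c x h => simp only [PathAlgebra.smul_mul', h]
  | path c d r =>
    induction y using induction_on with
    | zero => simp only [PathAlgebra.zero_mul', PathAlgebra.mul_zero']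
    | add x x' h h' => simp only [PathAlgebra.add_mul', PathAlgebra.mul_add', h, h']
    | smul c x h => simp only [PathAlgebra.smul_mul', PathAlgebra.mul_smul', h]
    | path b c' q =>
      induction z using induction_on with
      | zero => simp only [PathAlgebra.mul_zero']
      | add x x' h h' => simp only [PathAlgebra.mul_add', h, h']
      | smul c x h => simp only [PathAlgebra.mul_smul', h]
      | path a b' p =>
        by_cases h : c = c'
        · subst h
          by_cases h' : b = b'
          · subst h'
            simp only [ofPath_mul_ofPath, Quiver.Path.comp_assoc]
          · simp only [ofPath_mul_ofPath, ofPath_mul_ofPath_of_ne _ _ h', PathAlgebra.mul_zero']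
        · by_cases h' : b = b'
          · subst h'
            simp only [ofPath_mul_ofPath, ofPath_mul_ofPath_of_ne _ _ h, PathAlgebra.zero_mul']
          · simp only [ofPath_mul_ofPath_of_ne _ _ h, ofPath_mul_ofPath_of_ne _ _ h',
              PathAlgebra.zero_mul', PathAlgebra.mul_zero']

theorem one_def [Fintype V] :
    (1 : PathAlgebra K V) = ∑ a : V, ofPath K (Quiver.Path.nil : Quiver.Path a a) := rfl

protected theorem one_mul' [Fintype V] (x : PathAlgebra K V) : 1 * x = x := by
  induction x using induction_on with
  | zero => exact PathAlgebra.mul_zero' _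
  | add x x' h h' => rw [PathAlgebra.mul_add', h, h']
  | smul c x h => rw [PathAlgebra.mul_smul', h]
  | path a b p =>
    rw [one_def, mul_def, map_sum, LinearMap.sum_apply, Finset.sum_eq_single b]
    · rw [← mul_def, ofPath_mul_ofPath, Quiver.Path.comp_nil]
    · intro c _ hc
      rw [← mul_def, ofPath_mul_ofPath_of_ne _ _ hc]
    · intro h
      exact absurd (Finset.mem_univ b) h

protected theorem mul_one' [Fintype V] (x : PathAlgebra K V) : x * 1 = x := by
  induction x using induction_on with
  | zero => exact PathAlgebra.zero_mul' _
  | add x x' h h' => rw [PathAlgebra.add_mul', h, h']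
  | smul c x h => rw [PathAlgebra.smul_mul', h]
  | path a b p =>
    rw [one_def, mul_def, map_sum, Finset.sum_eq_single a]
    · rw [← mul_def, ofPath_mul_ofPath, Quiver.Path.nil_comp]
    · intro c _ hc
      rw [← mul_def, ofPath_mul_ofPath_of_ne _ _ hc.symm]
    · intro h
      exact absurd (Finset.mem_univ a) h

noncomputable instance [Fintype V] : Ring (PathAlgebra K V) :=
  { (inferInstance : AddCommGroup (PathAlgebra K V)) with
    mul := (· * ·)
    one := 1
    left_distrib := PathAlgebra.mul_add'
    right_distrib := PathAlgebra.add_mul'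
    zero_mul := PathAlgebra.zero_mul'
    mul_zero := PathAlgebra.mul_zero'
    mul_assoc := PathAlgebra.mul_assoc'
    one_mul := PathAlgebra.one_mul'
    mul_one := PathAlgebra.mul_one' }

noncomputable instance [Fintype V] : Algebra K (PathAlgebra K V) :=
  Algebra.ofModule PathAlgebra.smul_mul' PathAlgebra.mul_smul'

/-- The span of all paths of length at least `n`; this is the `n`-th power of the ideal generated by
the arrows. -/
noncomputable def lengthGE (K V : Type u) [Field K] [Quiver.{u} V] (n : ℕ) :
    Submodule K (PathAlgebra K V) :=
  Submodule.span K {x | ∃ (a b : V) (p : Quiver.Path a b), n ≤ p.length ∧ x = ofPath K p}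

/-- An ideal `I` is admissible if it lies between some power of the arrow ideal and the square of the
arrow ideal. -/
def IsAdmissible [Fintype V] (I : Ideal (PathAlgebra K V)) : Prop :=
  (∀ x ∈ I, x ∈ lengthGE K V 2) ∧ ∃ N : ℕ, ∀ x ∈ lengthGE K V N, x ∈ I

/-- The class of a path in the quotient `KΓ/I`. -/
noncomputable def pathClass [Fintype V] (I : Ideal (PathAlgebra K V)) [I.IsTwoSided] {a b : V}
    (p : Quiver.Path a b) : PathAlgebra K V ⧸ I :=
  Ideal.Quotient.mk I (ofPath K p)

end PathAlgebra

/-! ### Modules -/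

section Modules

variable (R : Type u) [Ring R]

/-- A module is uniserial if it has finite length and its submodules form a chain; equivalently, it
has exactly one composition series. -/
def IsUniserial (M : Type u) [AddCommGroup M] [Module R M] : Prop :=
  IsFiniteLength R M ∧ ∀ N N' : Submodule R M, N ≤ N' ∨ N' ≤ N

/-- A module is indecomposable if it is nonzero and not the direct sum of two nonzero submodules. -/
def IsIndecomposableModule (M : Type u) [AddCommGroup M] [Module R M] : Prop :=
  Nontrivial M ∧ ∀ N N' : Submodule R M, IsCompl N N' → N = ⊥ ∨ N' = ⊥

variable {R}

/-- A primitive idempotent: a nonzero idempotent that is not the sum of two nonzero orthogonal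
idempotents. -/
def IsPrimitiveIdempotent (e : R) : Prop :=
  IsIdempotentElem e ∧ e ≠ 0 ∧
    ∀ f g : R, IsIdempotentElem f → IsIdempotentElem g → f * g = 0 → g * f = 0 → e = f + g →
      f = 0 ∨ g = 0

variable (R)

/-- The left ideal `J e`, where `J` is the Jacobson radical of `R`. -/
noncomputable def radicalMul (e : R) : Submodule R R :=
  (Ring.jacobson R).map (LinearMap.toSpanSingleton R R e)

/-- A ring is left `m`-multiserial if, for each primitive idempotent `e`, the left ideal `J e` is the
(not necessarily direct) sum of `m` uniserial submodules, the zero module being allowed as a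
summand. -/
def IsLeftMultiserial (m : ℕ) : Prop :=
  ∀ e : R, IsPrimitiveIdempotent e →
    ∃ W : Fin m → Submodule R R, (∀ i, IsUniserial R (W i)) ∧ radicalMul R e = ⨆ i, W i

variable {R}

/-- A split monomorphism of modules. -/
def IsSplitMonoHom {A B : Type u} [AddCommGroup A] [Module R A] [AddCommGroup B] [Module R B]
    (f : A →ₗ[R] B) : Prop :=
  ∃ r : B →ₗ[R] A, r ∘ₗ f = LinearMap.id

/-- A split epimorphism of modules. -/
def IsSplitEpiHom {B C : Type u} [AddCommGroup B] [Module R B] [AddCommGroup C] [Module R C]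
    (g : B →ₗ[R] C) : Prop :=
  ∃ s : C →ₗ[R] B, g ∘ₗ s = LinearMap.id

/-- `f : A → B` is left almost split in the category of finitely generated modules: it is not a split
monomorphism, and every homomorphism from `A` to a finitely generated module that is not a split
monomorphism factors through `f`. -/
def IsLeftAlmostSplit {A B : Type u} [AddCommGroup A] [Module R A] [AddCommGroup B] [Module R B]
    (f : A →ₗ[R] B) : Prop :=
  ¬ IsSplitMonoHom f ∧
    ∀ (X : Type u) [AddCommGroup X] [Module R X] [Module.Finite R X] (h : A →ₗ[R] X),
      ¬ IsSplitMonoHom h → ∃ h' : B →ₗ[R] X, h' ∘ₗ f = h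

/-- `g : B → C` is right almost split in the category of finitely generated modules: it is not a split
epimorphism, and every homomorphism from a finitely generated module to `C` that is not a split
epimorphism factors through `g`. -/
def IsRightAlmostSplit {B C : Type u} [AddCommGroup B] [Module R B] [AddCommGroup C] [Module R C]
    (g : B →ₗ[R] C) : Prop :=
  ¬ IsSplitEpiHom g ∧
    ∀ (X : Type u) [AddCommGroup X] [Module R X] [Module.Finite R X] (h : X →ₗ[R] C),
      ¬ IsSplitEpiHom h → ∃ h' : X →ₗ[R] B, g ∘ₗ h' = h

/-- `0 → A → B → C → 0`, with maps `f` and `g`, is an almost split sequence. -/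
structure IsAlmostSplitSequence {A B C : Type u} [AddCommGroup A] [Module R A]
    [AddCommGroup B] [Module R B] [AddCommGroup C] [Module R C]
    (f : A →ₗ[R] B) (g : B →ₗ[R] C) : Prop where
  injective : Function.Injective f
  exact : Function.Exact f g
  surjective : Function.Surjective g
  leftAlmostSplit : IsLeftAlmostSplit f
  rightAlmostSplit : IsRightAlmostSplit g

variable (R)

/-- `M` is an (internal) direct sum of `n` indecomposable submodules. -/
def IsSumOfIndecomposables (M : Type u) [AddCommGroup M] [Module R M] (n : ℕ) : Prop :=
  ∃ N : Fin n → Submodule R M, DirectSum.IsInternal N ∧ ∀ i, IsIndecomposableModule R (N i)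

/-- There is an almost split sequence `0 → A → B → U → 0` of finitely generated modules whose middle
term `B` is a direct sum of `n` indecomposable modules. -/
def HasMiddleTermCount (U : Type u) [AddCommGroup U] [Module R U] (n : ℕ) : Prop :=
  ∃ (A B : ModuleCat.{u} R) (f : A →ₗ[R] B) (g : B →ₗ[R] U),
    Module.Finite R A ∧ Module.Finite R B ∧ IsAlmostSplitSequence f g ∧
      IsSumOfIndecomposables R B n

/-- `α(U) = n`: there is an almost split sequence ending in `U`, and `n` is the number of
indecomposable summands of the middle term, for every such sequence and every decomposition of its
middle term. -/
def AlphaEq (U : Type u) [AddCommGroup U] [Module R U] (n : ℕ) : Prop :=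
  HasMiddleTermCount R U n ∧ ∀ k : ℕ, HasMiddleTermCount R U k → k = n

/-- `α(U) ≤ n`. -/
def AlphaLE (U : Type u) [AddCommGroup U] [Module R U] (n : ℕ) : Prop :=
  ∃ k ≤ n, AlphaEq R U k

end Modules

/-- `p` is a mast of the module `U` over `KΓ/I`: its length is one less than the length of `U`, and
`p x ≠ 0` for some `x` in `U`. -/
def IsMast {K V : Type u} [Field K] [Quiver.{u} V] [Fintype V] (I : Ideal (PathAlgebra K V))
    [I.IsTwoSided] {a b : V} (p : Quiver.Path a b)
    (U : Type u) [AddCommGroup U] [Module (PathAlgebra K V ⧸ I) U] : Prop :=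
  Module.length (PathAlgebra K V ⧸ I) U = p.length + 1 ∧
    ∃ x : U, PathAlgebra.pathClass I p • x ≠ 0

/-! A uniserial module `U` with a mast starting at `a` is generated by an element `x = e_a x`.
Suppose that the relations of `x` form a left ideal `R ω` with `ω = e_c ω`. Then the transpose of
`U` is the cyclic right module `e_c R / ω R`, whose dual `A` has a simple socle, and the almost
split sequence is the pushout of `R ω → R e_a → U` along a map from `R ω` onto this socle.
Among the summands of its middle term at most one maps onto `U`, since `A` is uniform, and at most
one does not, since the submodules of `U` form a chain; a summand of the latter kind exists exactly
if the inclusion `J U → U` is irreducible. So `α(U)` is 2 or 1 according to whether `J U → U` is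
irreducible.

In (i) and (ii) the submodules of `J e_a` form a chain, so the relations form a left ideal `R ω`. In
(iii) write `J e_a = W + W'` with `W` and `W'` uniserial. Their images in `U` are comparable, so one
summand can be replaced by `R ω` for a relation `ω`, and `J p = 0` forces every relation into `R ω`.
Moreover `J p = 0` excludes irreducibility of `J U → U`: this inclusion factors through the pushout
of `R ← R → J U` given by `p` and `p x`, and neither factor splits.
-/

/-! ### Indecomposable modules -/

section IndecomposableModule

variable {R : Type u} [Ring R] {A B U : Type u} [AddCommGroup A] [Module R A]
  [AddCommGroup B] [Module R B] [AddCommGroup U] [Module R U]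

theorem map_eq_bot_iff_of_injective {φ : A →ₗ[R] B} (hφ : Function.Injective φ)
    {K : Submodule R A} : K.map φ = ⊥ ↔ K = ⊥ :=
  (Submodule.map_injective_of_injective hφ).eq_iff' (Submodule.map_bot φ)

theorem isIndecomposableModule_coe_iff {N : Submodule R B} :
    IsIndecomposableModule R N ↔
      N ≠ ⊥ ∧ ∀ L L' : Submodule R B, Disjoint L L' → L ⊔ L' = N → L = ⊥ ∨ L' = ⊥ := by
  rw [IsIndecomposableModule, Submodule.nontrivial_iff_ne_bot]
  refine and_congr_right fun _ => ⟨fun h L L' hd hs => ?_, fun h L L' hc => ?_⟩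
  · have hc : IsCompl (N.mapIic.symm ⟨L, le_sup_left.trans_eq hs⟩)
        (N.mapIic.symm ⟨L', le_sup_right.trans_eq hs⟩) := by
      rw [← N.mapIic.symm.isCompl_iff, Set.Iic.isCompl_iff]
      exact ⟨hd, hs⟩
    simpa only [map_eq_bot_iff, Subtype.ext_iff, Set.Iic.coe_bot] using h _ _ hc
  · obtain ⟨hd, hs⟩ := Set.Iic.isCompl_iff.1 (N.mapIic.isCompl_iff.1 hc)
    exact (h _ _ hd hs).imp (map_eq_bot_iff_of_injective N.injective_subtype).1
      (map_eq_bot_iff_of_injective N.injective_subtype).1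

theorem isIndecomposableModule_coe_top_iff :
    IsIndecomposableModule R (⊤ : Submodule R B) ↔ IsIndecomposableModule R B := by
  rw [isIndecomposableModule_coe_iff, IsIndecomposableModule,
    ← Submodule.nontrivial_iff_ne_bot, Submodule.topEquiv.toEquiv.nontrivial_congr]
  simp only [isCompl_iff, codisjoint_iff, and_imp]

theorem isIndecomposableModule_of_chain [Nontrivial U]
    (hU : ∀ N N' : Submodule R U, N ≤ N' ∨ N' ≤ N) : IsIndecomposableModule R U :=
  ⟨inferInstance, fun N N' hc => (hU N N').imp hc.disjoint.eq_bot_of_le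
    hc.symm.disjoint.eq_bot_of_le⟩

theorem isIndecomposableModule_coe_of_chain {N : Submodule R U}
    (hU : ∀ N N' : Submodule R U, N ≤ N' ∨ N' ≤ N) (hN : N ≠ ⊥) : IsIndecomposableModule R N :=
  isIndecomposableModule_coe_iff.2
    ⟨hN, fun L L' hd _ => (hU L L').imp hd.eq_bot_of_le hd.symm.eq_bot_of_le⟩

theorem IsIndecomposableModule.comp_eq_id [Nontrivial A] (hB : IsIndecomposableModule R B)
    {s : A →ₗ[R] B} {r : B →ₗ[R] A} (h : r ∘ₗ s = LinearMap.id) : s ∘ₗ r = LinearMap.id := by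
  have hrs : ∀ a, r (s a) = a := LinearMap.congr_fun h
  have hidem : IsIdempotentElem (s ∘ₗ r) := LinearMap.ext fun b => congrArg s (hrs (r b))
  rcases hB.2 _ _ (LinearMap.IsIdempotentElem.isCompl hidem) with h0 | h0
  · obtain ⟨a, ha⟩ := exists_ne (0 : A)
    have : s (r (s a)) = 0 := LinearMap.congr_fun (LinearMap.range_eq_bot.1 h0) (s a)
    rw [hrs] at this
    exact absurd (by rw [← hrs a, this, map_zero]) ha
  · exact LinearMap.ext fun b => LinearMap.ker_eq_bot.1 h0 (LinearMap.congr_fun hidem b)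

theorem exists_supIndep_isIndecomposableModule [IsArtinian R B] (N : Submodule R B) :
    ∃ s : Finset (Submodule R B),
      s.SupIndep id ∧ s.sup id = N ∧ ∀ L ∈ s, IsIndecomposableModule R L := by
  classical
  induction N using WellFoundedLT.induction with
  | ind N ih =>
    by_cases h0 : N = ⊥
    · exact ⟨∅, Finset.supIndep_empty _, h0.symm, by simp⟩
    by_cases hN : IsIndecomposableModule R N
    · exact ⟨{N}, Finset.supIndep_singleton _ _, Finset.sup_singleton, by simpa using hN⟩
    simp only [isIndecomposableModule_coe_iff, h0, ne_eq, not_false_eq_true, true_and,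
      not_forall, not_or] at hN
    obtain ⟨L, L', hd, rfl, hL, hL'⟩ := hN
    obtain ⟨s, hs, hsup, hind⟩ := ih L (left_lt_sup.2 fun h => hL' (hd.symm.eq_bot_of_le h))
    obtain ⟨t, ht, htup, hind'⟩ := ih L' (hd.right_lt_sup_of_left_ne_bot hL)
    refine ⟨s ∪ t, hs.union ht ?_, by rw [Finset.sup_union, hsup, htup], fun K hK => ?_⟩
    · rwa [hsup, htup]
    · exact (Finset.mem_union.1 hK).elim (hind K) (hind' K)

theorem exists_isSumOfIndecomposables [IsArtinian R B] : ∃ n, IsSumOfIndecomposables R B n := by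
  obtain ⟨s, hs, hsup, hind⟩ := exists_supIndep_isIndecomposableModule (⊤ : Submodule R B)
  refine ⟨s.card, fun i => (s.equivFin.symm i : Submodule R B), ?_,
    fun i => hind _ (s.equivFin.symm i).2⟩
  refine DirectSum.isInternal_submodule_of_iSupIndep_of_iSup_eq_top
    (hs.independent.comp s.equivFin.symm.injective) ?_
  rw [s.equivFin.symm.iSup_comp (g := fun L : s => (L : Submodule R B)), ← hsup,
    Finset.sup_eq_iSup, iSup_subtype]
  rfl

variable (R) in
/-- A module is uniform if any two of its nonzero submodules meet. The left end of the almost split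
sequences below is uniform, as its nonzero submodules all contain one nonzero element. -/
def IsUniformModule (A : Type u) [AddCommGroup A] [Module R A] : Prop :=
  ∀ K K' : Submodule R A, Disjoint K K' → K = ⊥ ∨ K' = ⊥

theorem IsUniformModule.of_injective (hB : IsUniformModule R B) {φ : A →ₗ[R] B}
    (hφ : Function.Injective φ) : IsUniformModule R A := fun _ _ hd =>
  (hB _ _ (Submodule.disjoint_map hφ hd)).imp (map_eq_bot_iff_of_injective hφ).1
    (map_eq_bot_iff_of_injective hφ).1

end IndecomposableModule

/-! ### Almost split sequences ending in a uniserial module -/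

section AlmostSplit

variable {R : Type u} [Ring R]

theorem exists_comp_eq_of_ker_le_ker {B U X : Type*} [AddCommGroup B] [Module R B]
    [AddCommGroup U] [Module R U] [AddCommGroup X] [Module R X] {g : B →ₗ[R] U}
    (hg : Function.Surjective g) {d : B →ₗ[R] X} (h : LinearMap.ker g ≤ LinearMap.ker d) :
    ∃ θ : U →ₗ[R] X, θ ∘ₗ g = d := by
  refine ⟨(LinearMap.ker g).liftQ d h ∘ₗ (g.quotKerEquivOfSurjective hg).symm.toLinearMap, ?_⟩
  ext b
  simp

theorem exists_comp_eq_of_exact {A B U X : Type*} [AddCommGroup A] [Module R A]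
    [AddCommGroup B] [Module R B] [AddCommGroup U] [Module R U] [AddCommGroup X] [Module R X]
    {f : A →ₗ[R] B} {g : B →ₗ[R] U} (hf : Function.Injective f) (hfg : Function.Exact f g)
    {d : X →ₗ[R] B} (h : g ∘ₗ d = 0) : ∃ φ : X →ₗ[R] A, f ∘ₗ φ = d :=
  ⟨(LinearEquiv.ofInjective f hf).symm.toLinearMap ∘ₗ
      d.codRestrict (LinearMap.range f) fun x => (hfg (d x)).1 (LinearMap.congr_fun h x),
    LinearMap.ext fun _ => congrArg Subtype.val ((LinearEquiv.ofInjective f hf).apply_symm_apply _)⟩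

variable {A B U : Type u} [AddCommGroup A] [Module R A] [AddCommGroup B] [Module R B]
  [AddCommGroup U] [Module R U] {f : A →ₗ[R] B} {g : B →ₗ[R] U}

/-- An irreducible homomorphism in the category of finitely generated modules: it splits on neither
side, and in each factorization of it through a finitely generated module one factor splits on the
corresponding side. -/
def IsIrreducibleHom (f : A →ₗ[R] B) : Prop :=
  ¬ IsSplitMonoHom f ∧ ¬ IsSplitEpiHom f ∧
    ∀ (Y : Type u) [AddCommGroup Y] [Module R Y] [Module.Finite R Y] (k : A →ₗ[R] Y)
      (l : Y →ₗ[R] B), l ∘ₗ k = f → IsSplitMonoHom k ∨ IsSplitEpiHom l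

theorem IsSplitMonoHom.injective (hf : IsSplitMonoHom f) : Function.Injective f :=
  let ⟨_, hr⟩ := hf
  Function.LeftInverse.injective (LinearMap.congr_fun hr)

theorem IsSplitEpiHom.surjective (hf : IsSplitEpiHom f) : Function.Surjective f :=
  let ⟨_, hs⟩ := hf
  Function.RightInverse.surjective (LinearMap.congr_fun hs)

theorem not_isSplitEpiHom_subtype {P : Submodule R U} (hP : P ≠ ⊤) : ¬ IsSplitEpiHom P.subtype :=
  fun h => hP (by rw [← P.range_subtype, LinearMap.range_eq_top.2 h.surjective])

theorem isCompl_biSup_compl_of_isInternal {ι : Type*} [DecidableEq ι] {N : ι → Submodule R B}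
    (hN : DirectSum.IsInternal N) (s : Set ι) : IsCompl (⨆ i ∈ s, N i) (⨆ i ∈ sᶜ, N i) :=
  ⟨hN.submodule_iSupIndep.disjoint_biSup_biSup disjoint_compl_right, codisjoint_iff.2
    (by rw [← hN.submodule_iSup_eq_top, iSup_split N (· ∈ s)]; rfl)⟩

namespace IsAlmostSplitSequence

theorem exists_lift_of_ne_top (h : IsAlmostSplitSequence f g) {P : Submodule R U}
    [Module.Finite R P] (hP : P ≠ ⊤) : ∃ l : P →ₗ[R] B, g ∘ₗ l = P.subtype :=
  h.rightAlmostSplit.2 P P.subtype (not_isSplitEpiHom_subtype hP)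

/-- If the endomorphism `φ` induced on `A` did not split, it would factor through `f`, and then `β`
minus this factorization would induce a section of `g`. -/
theorem injective_of_comp_eq [Module.Finite R A] (h : IsAlmostSplitSequence f g) {β : B →ₗ[R] B}
    (hβ : g ∘ₗ β = g) : Function.Injective β := by
  have hgf : g ∘ₗ f = 0 := h.exact.linearMap_comp_eq_zero
  obtain ⟨φ, hφ⟩ := exists_comp_eq_of_exact h.injective h.exact (d := β ∘ₗ f)
    (by rw [← LinearMap.comp_assoc, hβ, hgf])
  have hsplit : IsSplitMonoHom φ := by
    by_contra hns
    obtain ⟨ψ, hψ⟩ := h.leftAlmostSplit.2 A φ hns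
    obtain ⟨θ, hθ⟩ := exists_comp_eq_of_ker_le_ker h.surjective (d := β - f ∘ₗ ψ) (by
      rw [h.exact.linearMap_ker_eq, LinearMap.range_le_ker_iff, LinearMap.sub_comp,
        LinearMap.comp_assoc, hψ, hφ, sub_self])
    refine h.rightAlmostSplit.1 ⟨θ, LinearMap.cancel_right h.surjective |>.1 ?_⟩
    rw [LinearMap.comp_assoc, hθ, LinearMap.comp_sub, hβ, ← LinearMap.comp_assoc, hgf,
      LinearMap.zero_comp, sub_zero, LinearMap.id_comp]
  rw [injective_iff_map_eq_zero]
  intro b hb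
  obtain ⟨a, rfl⟩ := (h.exact b).1 (by rw [← hβ, LinearMap.comp_apply, hb, map_zero])
  have hφa : f (φ a) = 0 := (LinearMap.congr_fun hφ a).trans hb
  rw [(map_eq_zero_iff φ hsplit.injective).1 ((map_eq_zero_iff f h.injective).1 hφa), map_zero]

theorem exists_injective {A' B' : Type u} [AddCommGroup A'] [Module R A']
    [AddCommGroup B'] [Module R B'] {f' : A' →ₗ[R] B'} {g' : B' →ₗ[R] U}
    [Module.Finite R A'] [Module.Finite R B] [Module.Finite R B']
    (h : IsAlmostSplitSequence f g) (h' : IsAlmostSplitSequence f' g') :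
    ∃ φ : A' →ₗ[R] A, Function.Injective φ := by
  obtain ⟨β, hβ⟩ := h.rightAlmostSplit.2 B' g' h'.rightAlmostSplit.1
  obtain ⟨γ, hγ⟩ := h'.rightAlmostSplit.2 B g h.rightAlmostSplit.1
  have hβinj : Function.Injective β := Function.Injective.of_comp (f := γ)
    (h'.injective_of_comp_eq (β := γ ∘ₗ β) (by rw [← LinearMap.comp_assoc, hγ, hβ]))
  obtain ⟨φ, hφ⟩ := exists_comp_eq_of_exact h.injective h.exact (d := β ∘ₗ f')
    (by rw [← LinearMap.comp_assoc, hβ, h'.exact.linearMap_comp_eq_zero])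
  have hinj : Function.Injective (f ∘ₗ φ) := hφ ▸ hβinj.comp h'.injective
  exact ⟨φ, Function.Injective.of_comp (f := f) hinj⟩

/-- One of the summands, say `N'`, does not meet `A`; if both mapped onto `U`, then the projection
to `N` along `N'` would identify `A` with `N` and hence split `f`. -/
theorem map_ne_top_of_isCompl (h : IsAlmostSplitSequence f g) (hA : IsUniformModule R A)
    {N N' : Submodule R B} (hc : IsCompl N N') (hN : N.map g = ⊤) : N'.map g ≠ ⊤ := by
  intro hN'
  wlog hK : N'.comap f = ⊥ generalizing N N'
  · have hd : Disjoint (N.comap f) (N'.comap f) := Submodule.disjoint_def.2 fun a ha ha' =>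
      (map_eq_zero_iff f h.injective).1 (Submodule.disjoint_def.1 hc.disjoint _ ha ha')
    exact this hc.symm hN' hN ((hA _ _ hd).resolve_right hK)
  have hinj : Function.Injective (N.projectionOnto N' hc ∘ₗ f) := by
    rw [← LinearMap.ker_eq_bot, LinearMap.ker_comp, Submodule.ker_projectionOnto, hK]
  have hsurj : Function.Surjective (N.projectionOnto N' hc ∘ₗ f) := by
    intro n
    obtain ⟨n', hn', hgn'⟩ : -g n ∈ N'.map g := hN' ▸ Submodule.mem_top
    obtain ⟨a, ha⟩ := (h.exact (n + n')).1 (by rw [map_add, hgn', add_neg_cancel])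
    refine ⟨a, ?_⟩
    rw [LinearMap.comp_apply, ha, map_add, Submodule.projectionOnto_apply_left,
      (Submodule.projectionOnto_apply_eq_zero_iff hc).2 hn', add_zero]
  let E := LinearEquiv.ofBijective _ ⟨hinj, hsurj⟩
  exact h.leftAlmostSplit.1 ⟨E.symm.toLinearMap ∘ₗ N.projectionOnto N' hc,
    LinearMap.ext E.symm_apply_apply⟩

theorem not_isIndecomposableModule_of_isIrreducibleHom [IsNoetherian R U] [Module.Finite R B]
    (h : IsAlmostSplitSequence f g) {M : Submodule R U} (hM : M ≠ ⊤)
    (hirr : IsIrreducibleHom M.subtype) : ¬ IsIndecomposableModule R B := by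
  intro hB
  obtain ⟨l, hl⟩ := h.exists_lift_of_ne_top hM
  obtain ⟨r, hr⟩ := (hirr.2.2 B l g hl).resolve_right h.rightAlmostSplit.1
  have : Nontrivial M := by
    by_contra hsub
    have := not_nontrivial_iff_subsingleton.1 hsub
    exact hirr.1 ⟨0, Subsingleton.elim _ _⟩
  have hg : M.subtype ∘ₗ r = g := by
    rw [← hl, LinearMap.comp_assoc, hB.comp_eq_id hr, LinearMap.comp_id]
  have hsurj : Function.Surjective (M.subtype ∘ₗ r) := hg ▸ h.surjective
  have hsub : Function.Surjective M.subtype := hsurj.of_comp (g := r)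
  exact hM (by rw [← M.range_subtype, LinearMap.range_eq_top.2 hsub])

variable [IsArtinian R B] [Module.Finite R A]

/-- Replacing the inclusion of `N` by `θ` yields an endomorphism of `B` over `U`, which is an
automorphism. -/
theorem isSplitMonoHom_of_comp_eq (h : IsAlmostSplitSequence f g) {N N' : Submodule R B}
    (hc : IsCompl N N') {θ : N →ₗ[R] B} (hθ : g ∘ₗ θ = g ∘ₗ N.subtype) : IsSplitMonoHom θ := by
  let π := N.projectionOnto N' hc
  have hπ : ∀ n : N, π n = n := Submodule.projectionOnto_apply_left hc
  let β : B →ₗ[R] B := LinearMap.id + (θ - N.subtype) ∘ₗ π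
  have hβ : Function.Injective β := h.injective_of_comp_eq (by
    rw [LinearMap.comp_add, ← LinearMap.comp_assoc, LinearMap.comp_sub, hθ, sub_self,
      LinearMap.zero_comp, add_zero, LinearMap.comp_id])
  let E := LinearEquiv.ofBijective β (IsArtinian.bijective_of_injective_endomorphism β hβ)
  refine ⟨π ∘ₗ E.symm.toLinearMap, LinearMap.ext fun n => ?_⟩
  have hEn : E n = θ n := by simp [E, β, hπ]
  rw [LinearMap.comp_apply, ← hEn, LinearMap.comp_apply, LinearEquiv.coe_coe, E.symm_apply_apply,
    hπ, LinearMap.id_apply]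

variable [IsNoetherian R U]

theorem disjoint_ker_of_map_ne_top (h : IsAlmostSplitSequence f g) {N N' : Submodule R B}
    (hc : IsCompl N N') (hN : N.map g ≠ ⊤) : Disjoint N (LinearMap.ker g) := by
  obtain ⟨l, hl⟩ := h.exists_lift_of_ne_top hN
  have hsplit := h.isSplitMonoHom_of_comp_eq hc (θ := l ∘ₗ g.submoduleMap N) (by
    rw [← LinearMap.comp_assoc, hl]
    rfl)
  refine Submodule.disjoint_def.2 fun b hb hgb => ?_
  have hb0 : g.submoduleMap N ⟨b, hb⟩ = 0 := Subtype.ext hgb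
  exact congrArg Subtype.val ((map_eq_zero_iff _ hsplit.injective).1
    (by rw [LinearMap.comp_apply, hb0, map_zero]))

theorem eq_bot_or_eq_bot_of_map_ne_top (h : IsAlmostSplitSequence f g)
    (hU : ∀ P P' : Submodule R U, P ≤ P' ∨ P' ≤ P) {N₁ N₂ N' : Submodule R B}
    (hd : Disjoint N₁ N₂) (hc : IsCompl (N₁ ⊔ N₂) N')
    (h₁ : N₁.map g ≠ ⊤) (h₂ : N₂.map g ≠ ⊤) : N₁ = ⊥ ∨ N₂ = ⊥ := by
  have hmap : (N₁ ⊔ N₂).map g ≠ ⊤ := by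
    rw [Submodule.map_sup]
    rcases hU (N₁.map g) (N₂.map g) with hle | hle
    · rwa [sup_eq_right.2 hle]
    · rwa [sup_eq_left.2 hle]
  have hdis := h.disjoint_ker_of_map_ne_top hc hmap
  have hle {L L' : Submodule R B} (hL : L ≤ N₁ ⊔ N₂) (hL' : L' ≤ N₁ ⊔ N₂)
      (hmap : L.map g ≤ L'.map g) : L ≤ L' := by
    intro b hb
    obtain ⟨b', hb', hbb'⟩ := hmap ⟨b, hb, rfl⟩
    rwa [LinearMap.disjoint_ker_iff_injOn.1 hdis (hL hb) (hL' hb') hbb'.symm]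
  exact (hU (N₁.map g) (N₂.map g)).imp (fun hmap => hd.eq_bot_of_le
    (hle le_sup_left le_sup_right hmap)) (fun hmap => hd.symm.eq_bot_of_le
    (hle le_sup_right le_sup_left hmap))

theorem isIrreducibleHom_subtype (h : IsAlmostSplitSequence f g)
    (hU : ∀ P P' : Submodule R U, P ≤ P' ∨ P' ≤ P) {M : Submodule R U} (hM : M ≠ ⊤)
    {N N' : Submodule R B} (hc : IsCompl N N') (hN0 : N ≠ ⊥) (hN : N.map g ≤ M) :
    IsIrreducibleHom M.subtype := by
  have : Nontrivial N := Submodule.nontrivial_iff_ne_bot.2 hN0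
  let κ : N →ₗ[R] M := (g ∘ₗ N.subtype).codRestrict M fun n => hN ⟨n, n.2, rfl⟩
  have hκ {l : M →ₗ[R] B} (hl : g ∘ₗ l = M.subtype) : IsSplitMonoHom (l ∘ₗ κ) :=
    h.isSplitMonoHom_of_comp_eq hc (by rw [← LinearMap.comp_assoc, hl]; rfl)
  obtain ⟨l₀, hl₀⟩ := h.exists_lift_of_ne_top hM
  have hκinj : Function.Injective κ := Function.Injective.of_comp (f := l₀) (hκ hl₀).injective
  have : Nontrivial M := hκinj.nontrivial
  have : Nontrivial U := M.injective_subtype.nontrivial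
  refine ⟨fun ⟨r, hr⟩ => ?_, not_isSplitEpiHom_subtype hM, fun Y _ _ _ k l hlk => ?_⟩
  · have hid := (isIndecomposableModule_of_chain hU).comp_eq_id hr
    exact not_isSplitEpiHom_subtype hM ⟨r, hid⟩
  · refine or_iff_not_imp_right.2 fun hl => ?_
    obtain ⟨m, hm⟩ := h.rightAlmostSplit.2 Y l hl
    obtain ⟨ρ, hρ⟩ := hκ (l := m ∘ₗ k) (by rw [← LinearMap.comp_assoc, hm, hlk])
    have hMind := isIndecomposableModule_coe_of_chain hU (Submodule.nontrivial_iff_ne_bot.1 ‹_›)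
    exact ⟨κ ∘ₗ ρ ∘ₗ m, hMind.comp_eq_id (r := ρ ∘ₗ m ∘ₗ k) hρ⟩

/-- The values are propositions, so at most one summand maps onto `U` and at most one does not. -/
theorem injective_map_eq_top (h : IsAlmostSplitSequence f g) (hA : IsUniformModule R A)
    (hU : ∀ P P' : Submodule R U, P ≤ P' ∨ P' ≤ P) {ι : Type*} [DecidableEq ι]
    {N : ι → Submodule R B} (hN : DirectSum.IsInternal N) (hne : ∀ i, N i ≠ ⊥) :
    Function.Injective fun i => (N i).map g = ⊤ := by
  intro i j hij
  by_contra hne'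
  by_cases hi : (N i).map g = ⊤
  · refine h.map_ne_top_of_isCompl hA (isCompl_biSup_compl_of_isInternal hN {i})
      (by rwa [iSup_singleton]) (top_le_iff.1 ?_)
    exact (hij.mp hi).ge.trans (Submodule.map_mono (le_biSup N (Ne.symm hne')))
  · have hc := isCompl_biSup_compl_of_isInternal hN {i, j}
    rw [iSup_pair] at hc
    exact (h.eq_bot_or_eq_bot_of_map_ne_top hU (hN.submodule_iSupIndep.pairwiseDisjoint hne') hc
      hi fun hj => hi (hij.mpr hj)).elim (hne i) (hne j)

theorem card_eq_ite [Module.Finite R B] (h : IsAlmostSplitSequence f g) (hA : IsUniformModule R A)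
    (hU : ∀ P P' : Submodule R U, P ≤ P' ∨ P' ≤ P) {M : Submodule R U}
    (hM : IsGreatest {P : Submodule R U | P ≠ ⊤} M) {k : ℕ} (hk : IsSumOfIndecomposables R B k)
    [Decidable (IsIrreducibleHom M.subtype)] :
    k = if IsIrreducibleHom M.subtype then 2 else 1 := by
  obtain ⟨N, hN, hind⟩ := hk
  have hne (i : Fin k) : N i ≠ ⊥ := Submodule.nontrivial_iff_ne_bot.1 (hind i).1
  have hinj := h.injective_map_eq_top hA hU hN hne
  have hle : k ≤ 2 := by simpa using Fintype.card_le_of_injective _ hinj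
  interval_cases k
  · have hB : (⊤ : Submodule R B).map g = ⊥ := by
      rw [← hN.submodule_iSup_eq_top, iSup_of_empty, Submodule.map_bot]
    rw [Submodule.map_top, LinearMap.range_eq_top.2 h.surjective] at hB
    exact absurd (top_le_iff.1 (hB.le.trans bot_le)) hM.1
  · have hB : IsIndecomposableModule R B := by
      rw [← isIndecomposableModule_coe_top_iff, ← hN.submodule_iSup_eq_top, ciSup_unique]
      exact hind _
    exact (if_neg fun hirr => h.not_isIndecomposableModule_of_isIrreducibleHom hM.1 hirr hB).symm
  · obtain ⟨i, hi⟩ : ∃ i, (N i).map g ≠ ⊤ := by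
      by_contra! hall
      exact absurd (@hinj 0 1 (by simp only [hall])) (by decide)
    have hc := isCompl_biSup_compl_of_isInternal hN {i}
    rw [iSup_singleton] at hc
    exact (if_pos (h.isIrreducibleHom_subtype hU hM.1 hc (hne i) (hM.2 hi))).symm

open Classical in
theorem alphaEq_ite [IsArtinianRing R] [Module.Finite R B] (h : IsAlmostSplitSequence f g)
    (hA : IsUniformModule R A) (hU : ∀ P P' : Submodule R U, P ≤ P' ∨ P' ≤ P) {M : Submodule R U}
    (hM : IsGreatest {P : Submodule R U | P ≠ ⊤} M) :
    AlphaEq R U (if IsIrreducibleHom M.subtype then 2 else 1) := by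
  constructor
  · obtain ⟨k, hk⟩ := exists_isSumOfIndecomposables (R := R) (B := B)
    rw [← h.card_eq_ite hA hU hM hk]
    exact ⟨ModuleCat.of R A, ModuleCat.of R B, f, g, inferInstance, inferInstance, h, hk⟩
  · rintro k ⟨A', B', f', g', hA', hB', h', hk⟩
    obtain ⟨φ, hφ⟩ := h.exists_injective h'
    exact h'.card_eq_ite (hA.of_injective hφ) hU hM hk

end IsAlmostSplitSequence

end AlmostSplit

/-! ### Split basic algebras -/

/-- The idempotents `e v` and the characters `ε v` exhibit `R` as a split basic algebra: the
characters are dual to the idempotents, and their common kernel, which is then the Jacobson radical,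
consists of nilpotent elements. -/
structure IsSplitBasic {K R V : Type u} [Field K] [Ring R] [Algebra K R] [Fintype V]
    (e : V → R) (ε : V → R →ₐ[K] K) : Prop where
  isIdempotentElem : ∀ v, IsIdempotentElem (e v)
  sum_eq_one : ∑ v, e v = 1
  apply_self : ∀ v, ε v (e v) = 1
  apply_of_ne : ∀ v w, v ≠ w → ε v (e w) = 0
  isNilpotent : ∀ r, (∀ v, ε v r = 0) → IsNilpotent r

namespace IsSplitBasic

variable {K R V : Type u} [Field K] [Ring R] [Algebra K R] [Fintype V]
  {e : V → R} {ε : V → R →ₐ[K] K}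

theorem mem_jacobson (hs : IsSplitBasic e ε) {r : R} :
    r ∈ Ring.jacobson R ↔ ∀ v, ε v r = 0 := by
  refine ⟨fun hr v => ?_, fun hr => ?_⟩
  · have hsurj : Function.Surjective (ε v : R →+* K) := fun c =>
      ⟨algebraMap K R c, (ε v).commutes c⟩
    have : RingHomSurjective (ε v : R →+* K) := ⟨hsurj⟩
    have h := Ring.le_comap_jacobson (ε v : R →+* K) hr
    rwa [Ring.jacobson, IsSemisimpleModule.jacobson_eq_bot] at h
  · rw [← Ideal.jacobson_bot, Ideal.mem_jacobson_iff]
    intro y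
    obtain ⟨u, hu⟩ := (hs.isNilpotent (y * r) fun v => by rw [map_mul, hr, mul_zero]).isUnit_one_add
    refine ⟨↑u⁻¹, ?_⟩
    rw [mul_assoc, ← mul_add_one, add_comm, ← hu, Units.inv_mul, sub_self]
    exact zero_mem _

theorem mul_mem_jacobson (hs : IsSplitBasic e ε) {r : R} {v : V} (h : ε v r = 0) :
    r * e v ∈ Ring.jacobson R := by
  refine hs.mem_jacobson.2 fun w => ?_
  rcases eq_or_ne w v with rfl | hw
  · rw [map_mul, h, zero_mul]
  · rw [map_mul, hs.apply_of_ne w v hw, mul_zero]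

theorem mul_sub_smul_mem_jacobson (hs : IsSplitBasic e ε) (r : R) (v : V) :
    r * e v - ε v r • e v ∈ Ring.jacobson R := by
  rw [Algebra.smul_def, ← sub_mul]
  exact hs.mul_mem_jacobson (by rw [map_sub, AlgHom.commutes, Algebra.algebraMap_self_apply,
    sub_self])

theorem isUnit_algebraMap_add (hs : IsSplitBasic e ε) {c : K} (hc : c ≠ 0) {j : R}
    (hj : j ∈ Ring.jacobson R) : IsUnit (algebraMap K R c + j) :=
  (hs.isNilpotent j (hs.mem_jacobson.1 hj)).isUnit_add_left_of_commute
    ((IsUnit.mk0 c hc).map (algebraMap K R)) (Algebra.commutes c j).symm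

theorem exists_mul_mul_eq (hs : IsSplitBasic e ε) {r : R} {v : V} (h : ε v r ≠ 0) :
    ∃ s, s * r * e v = e v := by
  obtain ⟨u, hu⟩ := hs.isUnit_algebraMap_add h (hs.mul_sub_smul_mem_jacobson r v)
  have hr : u * e v = r * e v := by
    rw [hu, add_mul, sub_mul, mul_assoc, hs.isIdempotentElem v, smul_mul_assoc,
      hs.isIdempotentElem v, ← Algebra.smul_def, add_sub_cancel]
  exact ⟨↑u⁻¹, by rw [mul_assoc, ← hr, ← mul_assoc, Units.inv_mul, one_mul]⟩

theorem eq_zero_of_isIdempotentElem (hs : IsSplitBasic e ε) {f : R} (hf : IsIdempotentElem f)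
    (h : ∀ v, ε v f = 0) : f = 0 := by
  obtain ⟨n, hn⟩ := hs.isNilpotent f h
  rw [← hf.pow_succ_eq n, pow_succ, hn, zero_mul]

theorem isPrimitiveIdempotent (hs : IsSplitBasic e ε) (v : V) : IsPrimitiveIdempotent (e v) := by
  refine ⟨hs.isIdempotentElem v, fun h => ?_, fun f g hf hg hfg hgf hefg => ?_⟩
  · exact zero_ne_one ((map_zero (ε v)).symm.trans (h ▸ hs.apply_self v))
  · have eq_zero {f : R} (hf : IsIdempotentElem f) (hef : e v * f = f) (h0 : ε v f = 0) :
        f = 0 := by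
      refine hs.eq_zero_of_isIdempotentElem hf fun w => ?_
      rcases eq_or_ne w v with rfl | hw
      · exact h0
      · rw [← hef, map_mul, hs.apply_of_ne w v hw, zero_mul]
    have h0 : ε v f * ε v g = 0 := by rw [← map_mul, hfg, map_zero]
    exact (mul_eq_zero.1 h0).imp (eq_zero hf (by rw [hefg, add_mul, hgf, hf.eq, add_zero]))
      (eq_zero hg (by rw [hefg, add_mul, hfg, hg.eq, zero_add]))

section Modules

variable {N : Type*} [AddCommGroup N] [Module R N]

theorem exists_smul_notMem (hs : IsSplitBasic e ε) {P : Submodule R N} {x : N} (hx : x ∉ P) :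
    ∃ v, e v • x ∉ P := by
  by_contra! h
  refine hx ?_
  rw [← one_smul R x, ← hs.sum_eq_one, Finset.sum_smul]
  exact sum_mem fun v _ => h v

theorem mem_of_smul_mem (hs : IsSplitBasic e ε) {P : Submodule R N} {r : R} {v : V} {x : N}
    (hr : ε v r ≠ 0) (hx : e v • x = x) (h : r • x ∈ P) : x ∈ P := by
  obtain ⟨s, hsr⟩ := hs.exists_mul_mul_eq hr
  rw [← hx, ← hsr, mul_smul, hx, mul_smul]
  exact P.smul_mem s h

theorem exists_mem_jacobson_of_mem_span (hs : IsSplitBasic e ε) {P : Submodule R N} {v : V}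
    {x z : N} (hx : e v • x = x) (hxP : x ∉ P) (hzP : z ∈ P) (hz : z ∈ Submodule.span R {x}) :
    ∃ j ∈ Ring.jacobson R, z = j • x := by
  obtain ⟨r, rfl⟩ := Submodule.mem_span_singleton.1 hz
  by_cases hr : ε v r = 0
  · exact ⟨r * e v, hs.mul_mem_jacobson hr, by rw [mul_smul, hx]⟩
  · exact absurd (hs.mem_of_smul_mem hr hx hzP) hxP

theorem span_eq_top_of_notMem (hs : IsSplitBasic e ε)
    (hN : ∀ P P' : Submodule R N, P ≤ P' ∨ P' ≤ P) {x : N}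
    (hx : x ∉ Ring.jacobson R • (⊤ : Submodule R N)) : Submodule.span R {x} = ⊤ := by
  by_contra htop
  obtain ⟨y, hy⟩ : ∃ y, y ∉ Submodule.span R {x} := by
    simpa only [Submodule.eq_top_iff', not_forall] using htop
  obtain ⟨w, hw⟩ := hs.exists_smul_notMem hy
  have hxy : x ∈ Submodule.span R {e w • y} :=
    (hN (Submodule.span R {e w • y}) (Submodule.span R {x})).elim
      (fun h => absurd (h (Submodule.mem_span_singleton_self _)) hw)
      (fun h => h (Submodule.mem_span_singleton_self _))
  obtain ⟨j, hj, rfl⟩ := hs.exists_mem_jacobson_of_mem_span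
    (by rw [smul_smul, hs.isIdempotentElem w]) hw (Submodule.mem_span_singleton_self x) hxy
  exact hx (Submodule.smul_mem_smul hj Submodule.mem_top)

theorem isGreatest_jacobson_smul_top (hs : IsSplitBasic e ε) [Nontrivial N] [IsNoetherian R N]
    (hN : ∀ P P' : Submodule R N, P ≤ P' ∨ P' ≤ P) :
    IsGreatest {P : Submodule R N | P ≠ ⊤} (Ring.jacobson R • ⊤) := by
  refine ⟨(Submodule.jacobson_smul_lt_top ⊤).ne, fun P hP x hxP => ?_⟩
  by_contra hx
  refine hP (top_le_iff.1 ?_)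
  rwa [← hs.span_eq_top_of_notMem hN hx, Submodule.span_singleton_le_iff_mem]

theorem exists_span_eq_top (hs : IsSplitBasic e ε) [Nontrivial N] [IsNoetherian R N]
    (hN : ∀ P P' : Submodule R N, P ≤ P' ∨ P' ≤ P) :
    ∃ (v : V) (x : N), e v • x = x ∧ Submodule.span R {x} = ⊤ := by
  obtain ⟨z, -, hz⟩ := SetLike.exists_of_lt (Submodule.jacobson_smul_lt_top (⊤ : Submodule R N))
  obtain ⟨v, hv⟩ := hs.exists_smul_notMem hz
  exact ⟨v, e v • z, by rw [smul_smul, hs.isIdempotentElem v], hs.span_eq_top_of_notMem hN hv⟩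

theorem exists_eq_span (hs : IsSplitBasic e ε) [IsNoetherian R N] [Nonempty V] (P : Submodule R N)
    (hP : ∀ Q Q' : Submodule R P, Q ≤ Q' ∨ Q' ≤ Q) :
    ∃ (v : V) (x : N), e v • x = x ∧ P = Submodule.span R {x} := by
  rcases subsingleton_or_nontrivial P with h | h
  · exact ⟨Classical.arbitrary V, 0, smul_zero _,
      by rw [Submodule.span_zero_singleton, Submodule.subsingleton_iff_eq_bot.1 h]⟩
  · obtain ⟨v, x, hx, hspan⟩ := hs.exists_span_eq_top hP
    refine ⟨v, x, congrArg Subtype.val hx, ?_⟩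
    have hmap := congrArg (Submodule.map P.subtype) hspan
    rw [Submodule.map_span, Set.image_singleton, Submodule.map_top, Submodule.range_subtype] at hmap
    exact hmap.symm

end Modules

end IsSplitBasic

/-! ### Duals of cyclic right modules -/

/-- The `K`-dual of `R`, as a left `R`-module by `(r • a) y = a (y * r)`. -/
def DualModule (K R : Type u) [Field K] [Ring R] [Algebra K R] : Type u :=
  Module.Dual K R

namespace DualModule

variable {K R : Type u} [Field K] [Ring R] [Algebra K R]

noncomputable instance : AddCommGroup (DualModule K R) :=
  inferInstanceAs (AddCommGroup (Module.Dual K R))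

noncomputable instance : Module K (DualModule K R) :=
  inferInstanceAs (Module K (Module.Dual K R))

instance : FunLike (DualModule K R) R K :=
  inferInstanceAs (FunLike (Module.Dual K R) R K)

instance : LinearMapClass (DualModule K R) K R K :=
  inferInstanceAs (LinearMapClass (Module.Dual K R) K R K)

noncomputable instance : SMul R (DualModule K R) :=
  ⟨fun r a => (show Module.Dual K R from a) ∘ₗ LinearMap.mulRight K r⟩

@[ext]
theorem ext {a b : DualModule K R} (h : ∀ y, a y = b y) : a = b :=
  LinearMap.ext h

@[simp]
theorem smul_apply (r : R) (a : DualModule K R) (y : R) : (r • a) y = a (y * r) := rfl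

@[simp]
theorem add_apply (a b : DualModule K R) (y : R) : (a + b) y = a y + b y := rfl

@[simp]
theorem zero_apply (y : R) : (0 : DualModule K R) y = 0 := rfl

@[simp]
theorem field_smul_apply (c : K) (a : DualModule K R) (y : R) : (c • a) y = c * a y := rfl

noncomputable instance : Module R (DualModule K R) where
  one_smul a := by ext y; simp
  mul_smul r s a := by ext y; simp [mul_assoc]
  smul_zero r := by ext; simp
  smul_add r a b := by ext y; simp
  add_smul r s a := by ext y; simp [mul_add]
  zero_smul a := by ext y; simp

instance : IsScalarTower K R (DualModule K R) where
  smul_assoc c r a := by ext y; simp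

instance [Module.Finite K R] : Module.Finite R (DualModule K R) :=
  haveI : Module.Finite K (DualModule K R) := inferInstanceAs (Module.Finite K (Module.Dual K R))
  Module.Finite.of_restrictScalars_finite K R (DualModule K R)

end DualModule

/-- The dual of the right module `f R / ω R`, for an idempotent `f` with `f ω = ω`: a functional on
`f R / ω R` is identified with the functional `y ↦ a (f y)` on `R`. -/
def transposeDual (K : Type u) {R : Type u} [Field K] [Ring R] [Algebra K R] (f ω : R) :
    Submodule R (DualModule K R) where
  carrier := {a | ∀ y, a (f * y) = a y ∧ a (ω * y) = 0}
  add_mem' ha hb y := by simp [(ha y).1, (hb y).1, (ha y).2, (hb y).2]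
  zero_mem' y := by simp
  smul_mem' r a ha y := by simp [mul_assoc, (ha (y * r)).1, (ha (y * r)).2]

section TransposeDual

variable {K R : Type u} [Field K] [Ring R] [Algebra K R] {f ω : R}

theorem transposeDual_apply_mul (a : transposeDual K f ω) (y : R) : a.1 (f * y) = a.1 y := (a.2 y).1

theorem transposeDual_apply_rel (a : transposeDual K f ω) : a.1 ω = 0 :=
  (congrArg a.1 (mul_one ω)).symm.trans (a.2 1).2

/-- The homomorphism to the dual of `f R / ω R` that corresponds to a functional vanishing on `ω E`,
under `Hom_R(E, D(f R / ω R)) = D((f R / ω R) ⊗_R E)`. -/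
def homOfFunctional (hf : IsIdempotentElem f) (hω : f * ω = ω) {E : Type*} [AddCommGroup E]
    [Module R E] [Module K E] [IsScalarTower K R E] (φ : E →ₗ[K] K) (hφ : ∀ q, φ (ω • q) = 0) :
    E →ₗ[R] transposeDual K f ω where
  toFun q := ⟨(φ ∘ₗ (LinearMap.toSpanSingleton R E q).restrictScalars K ∘ₗ LinearMap.mulLeft K f :
      Module.Dual K R), fun y => by
    constructor
    · change φ ((f * (f * y)) • q) = φ ((f * y) • q)
      rw [← mul_assoc, hf]
    · change φ ((f * (ω * y)) • q) = 0
      rw [← mul_assoc, hω, mul_smul, hφ]⟩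
  map_add' q q' := by
    ext y
    change φ ((f * y) • (q + q')) = φ ((f * y) • q) + φ ((f * y) • q')
    rw [smul_add, map_add]
  map_smul' r q := by
    ext y
    change φ ((f * y) • r • q) = φ ((f * (y * r)) • q)
    rw [← mul_smul, mul_assoc]

variable (hf : IsIdempotentElem f) (hω : f * ω = ω) {E : Type*} [AddCommGroup E] [Module R E]

section

variable [Module K E] [IsScalarTower K R E]

theorem homOfFunctional_apply {φ : E →ₗ[K] K} {hφ : ∀ q, φ (ω • q) = 0} (q : E) (y : R) :
    (homOfFunctional hf hω φ hφ q).1 y = φ ((f * y) • q) := rfl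

end

include hf hω

theorem exists_comp_eq_id_of_smul_eq (ι : transposeDual K f ω →ₗ[R] E)
    (h : ∀ (q : E) (a : transposeDual K f ω), ω • q = ι a → a.1 1 = 0) :
    ∃ ρ : E →ₗ[R] transposeDual K f ω, ρ ∘ₗ ι = LinearMap.id := by
  let : Module K E := Module.compHom E (algebraMap K R)
  have : IsScalarTower K R E := .of_algebraMap_smul fun _ _ => rfl
  let S : Submodule K E := LinearMap.range (Algebra.lsmul K K E ω)
  let ιK : transposeDual K f ω →ₗ[K] E ⧸ S := S.mkQ ∘ₗ ι.restrictScalars K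
  let evalOne : Module.Dual K (transposeDual K f ω) :=
    { toFun := fun a => a.1 1, map_add' := fun _ _ => rfl, map_smul' := fun _ _ => rfl }
  have hev : evalOne ∈ LinearMap.range ιK.dualMap := by
    rw [LinearMap.range_dualMap_eq_dualAnnihilator_ker, Submodule.mem_dualAnnihilator]
    intro a ha
    obtain ⟨q, hq⟩ := (Submodule.Quotient.mk_eq_zero S).1 ha
    exact h q a hq
  obtain ⟨φ, hφ⟩ := hev
  have hφι (a : transposeDual K f ω) : φ (S.mkQ (ι a)) = a.1 1 := LinearMap.congr_fun hφ a
  have hφS (q : E) : (φ ∘ₗ S.mkQ) (ω • q) = 0 := by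
    have hq : S.mkQ (ω • q) = 0 := (Submodule.Quotient.mk_eq_zero S).2 ⟨q, rfl⟩
    rw [LinearMap.comp_apply, hq, map_zero]
  refine ⟨homOfFunctional hf hω (φ ∘ₗ S.mkQ) hφS, ?_⟩
  ext a y
  rw [LinearMap.comp_apply, homOfFunctional_apply, LinearMap.comp_apply, ← map_smul, hφι,
    Submodule.coe_smul, DualModule.smul_apply, one_mul, transposeDual_apply_mul, LinearMap.id_apply]

variable (K) in
theorem exists_hom_apply_ne_zero {z : E} (hz : f • z = z) (h : ∀ q : E, ω • q ≠ z) :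
    ∃ ρ : E →ₗ[R] transposeDual K f ω, ρ z ≠ 0 := by
  let : Module K E := Module.compHom E (algebraMap K R)
  have : IsScalarTower K R E := .of_algebraMap_smul fun _ _ => rfl
  have hz' : z ∉ LinearMap.range (Algebra.lsmul K K E ω) := fun ⟨q, hq⟩ => h q hq
  obtain ⟨φ, hφz, hφ⟩ := Submodule.exists_le_ker_of_notMem hz'
  refine ⟨homOfFunctional hf hω φ fun q => hφ ⟨q, rfl⟩, fun h0 => hφz ?_⟩
  rw [← hz, ← mul_one f, ← homOfFunctional_apply hf hω (hφ := fun q => hφ ⟨q, rfl⟩), h0]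
  rfl

end TransposeDual

/-! ### Modules with one relation -/

section RelationModule

variable {R : Type u} [Ring R] {U : Type*} [AddCommGroup U] [Module R U]

/-- The relations of the element `x` that lie in the left ideal `R f`: if `f x = x`, this is the
kernel of the homomorphism `R f → U` that maps `f` to `x`. -/
def relationModule (f : R) (x : U) : Submodule R R :=
  LinearMap.ker (LinearMap.toSpanSingleton R U x) ⊓ Submodule.span R {f}

variable {f : R} {x : U}

theorem mem_relationModule (hf : IsIdempotentElem f) {r : R} :
    r ∈ relationModule f x ↔ r • x = 0 ∧ r * f = r := by
  refine and_congr_right fun _ => Submodule.mem_span_singleton.trans ⟨?_, fun h => ⟨r, h⟩⟩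
  rintro ⟨s, rfl⟩
  rw [smul_eq_mul, mul_assoc, hf]

theorem mul_mem_relationModule (hf : IsIdempotentElem f) (hx : f • x = x) {r : R}
    (hr : r • x = 0) : r * f ∈ relationModule f x :=
  (mem_relationModule hf).2 ⟨by rw [mul_smul, hx, hr], by rw [mul_assoc, hf]⟩

theorem exists_smul_eq_of_span_eq_top (hx : Submodule.span R {x} = ⊤) (y : U) :
    ∃ r : R, r • x = y :=
  Submodule.mem_span_singleton.1 (hx ▸ Submodule.mem_top)

theorem exists_hom_of_relationModule (hf : IsIdempotentElem f) (hx : f • x = x)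
    (hspan : Submodule.span R {x} = ⊤) {X : Type*} [AddCommGroup X] [Module R X] {q : X}
    (hq : ∀ r ∈ relationModule f x, r • q = 0) : ∃ σ : U →ₗ[R] X, σ x = f • q := by
  obtain ⟨σ, hσ⟩ := exists_comp_eq_of_ker_le_ker (g := LinearMap.toSpanSingleton R U x)
    (exists_smul_eq_of_span_eq_top hspan) (d := LinearMap.toSpanSingleton R X (f • q))
    fun r hr => by
      rw [LinearMap.mem_ker, LinearMap.toSpanSingleton_apply, ← mul_smul]
      exact hq _ (mul_mem_relationModule hf hx hr)
  refine ⟨σ, ?_⟩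
  simpa only [LinearMap.comp_apply, LinearMap.toSpanSingleton_apply, one_smul] using
    LinearMap.congr_fun hσ 1

theorem ne_zero_of_not_projective (hspan : Submodule.span R {x} = ⊤)
    (hU : ¬ Module.Projective R U) : x ≠ 0 := by
  rintro rfl
  rw [Submodule.span_zero_singleton] at hspan
  have : Subsingleton U := (Submodule.subsingleton_iff R).1 (subsingleton_of_bot_eq_top hspan)
  exact hU inferInstance

theorem relationModule_ne_bot (hf : IsIdempotentElem f) (hx : f • x = x)
    (hspan : Submodule.span R {x} = ⊤) (hU : ¬ Module.Projective R U) :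
    relationModule f x ≠ ⊥ := by
  intro h0
  obtain ⟨σ, hσ⟩ := exists_hom_of_relationModule hf hx hspan (q := (1 : R)) fun r hr => by
    have hr0 : r ∈ (⊥ : Submodule R R) := h0 ▸ hr
    rw [(Submodule.mem_bot R).1 hr0, zero_smul]
  refine hU (Module.Projective.of_split σ (LinearMap.toSpanSingleton R U x) ?_)
  ext y
  obtain ⟨r, rfl⟩ := exists_smul_eq_of_span_eq_top hspan y
  rw [LinearMap.comp_apply, map_smul, hσ, LinearMap.toSpanSingleton_apply, smul_assoc,
    smul_eq_mul, mul_one, hx, LinearMap.id_apply]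

end RelationModule

/-- The nonzero element `x` generates the module, is supported at the vertex `a`, and its relations
are generated by one nonzero element `ω`, which ends at the vertex `c`. -/
structure IsOneRelation {R V : Type u} [Ring R] (e : V → R) (a c : V) (ω : R) {U : Type u}
    [AddCommGroup U] [Module R U] (x : U) : Prop where
  smul_self : e a • x = x
  span_eq_top : Submodule.span R {x} = ⊤
  gen_ne_zero : x ≠ 0
  left_mul : e c * ω = ω
  rel_ne_zero : ω ≠ 0
  relationModule_eq : relationModule (e a) x = Submodule.span R {ω}

namespace IsOneRelation

variable {K R V : Type u} [Field K] [Ring R] [Algebra K R] [Fintype V]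
  {e : V → R} {ε : V → R →ₐ[K] K} {a c : V} {ω : R}
  {U : Type u} [AddCommGroup U] [Module R U] {x : U}

section Relation

variable (h : IsOneRelation e a c ω x) (hs : IsSplitBasic e ε)
include h hs

theorem rel_mem : ω • x = 0 ∧ ω * e a = ω :=
  (mem_relationModule (hs.isIdempotentElem a)).1
    (h.relationModule_eq ▸ Submodule.mem_span_singleton_self ω)

theorem apply_rel (v : V) : ε v ω = 0 := by
  obtain ⟨hωx, hωa⟩ := h.rel_mem hs
  have ha : ε a ω = 0 := by
    by_contra ha
    exact h.gen_ne_zero ((Submodule.mem_bot R).1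
      (hs.mem_of_smul_mem ha h.smul_self ((Submodule.mem_bot R).2 hωx)))
  rcases eq_or_ne v a with rfl | hv
  · exact ha
  · rw [← hωa, map_mul, hs.apply_of_ne v a hv, mul_zero]

theorem apply_eq_zero_of_mul_rel {r : R} (hr : r * ω = 0) : ε c r = 0 := by
  by_contra hc
  exact h.rel_ne_zero ((Submodule.mem_bot R).1
    (hs.mem_of_smul_mem (N := R) hc h.left_mul ((Submodule.mem_bot R).2 hr)))

theorem exists_mul_rel {r : R} (hr : r • x = 0) : ∃ l, l * ω = r * e a := by
  have hmem := mul_mem_relationModule (hs.isIdempotentElem a) h.smul_self hr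
  rw [h.relationModule_eq] at hmem
  exact Submodule.mem_span_singleton.1 hmem

theorem exists_hom {X : Type*} [AddCommGroup X] [Module R X] {q : X} (hq : ω • q = 0) :
    ∃ σ : U →ₗ[R] X, σ x = e a • q := by
  refine exists_hom_of_relationModule (hs.isIdempotentElem a) h.smul_self h.span_eq_top
    fun r hr => ?_
  obtain ⟨l, rfl⟩ := Submodule.mem_span_singleton.1 (h.relationModule_eq ▸ hr)
  rw [smul_assoc, hq, smul_zero]

theorem isSplitEpiHom_of_smul_eq [IsNoetherian R U] {X : Type u} [AddCommGroup X] [Module R X]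
    {k : X →ₗ[R] U} {q : X} (hq : ω • q = 0) {r : R} (hr : r • x = k q) (hra : ε a r ≠ 0) :
    IsSplitEpiHom k := by
  obtain ⟨σ, hσ⟩ := h.exists_hom hs hq
  have hx : x ∈ LinearMap.range (k ∘ₗ σ) := by
    refine hs.mem_of_smul_mem (v := a) (r := e a * r)
      (by rwa [map_mul, hs.apply_self, one_mul]) h.smul_self ⟨x, ?_⟩
    rw [LinearMap.comp_apply, hσ, map_smul, ← hr, mul_smul]
  have hsurj : LinearMap.range (k ∘ₗ σ) = ⊤ :=
    top_le_iff.1 (h.span_eq_top ▸ (Submodule.span_singleton_le_iff_mem x _).2 hx)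
  let E := LinearEquiv.ofBijective _
    (IsNoetherian.bijective_of_surjective_endomorphism _ (LinearMap.range_eq_top.1 hsurj))
  exact ⟨σ ∘ₗ E.symm.toLinearMap, LinearMap.ext E.apply_symm_apply⟩

/-- The element `e_a r e_a` of the radical is nilpotent, and multiplication by `ω` turns its powers
into powers of `l`. -/
theorem apply_eq_zero_of_mul_eq {r l : R} (hra : ε a r = 0) (hl : ω * r * e a = l * ω) :
    ε c l = 0 := by
  have hωa := (h.rel_mem hs).2
  have hsemi : SemiconjBy ω (e a * r * e a) l := by
    rw [SemiconjBy, ← mul_assoc, ← mul_assoc, hωa, hl]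
  obtain ⟨n, hn⟩ := hs.isNilpotent (e a * r * e a) fun v => by
    rcases eq_or_ne v a with rfl | hv
    · rw [map_mul, map_mul, hra, mul_zero, zero_mul]
    · rw [map_mul, hs.apply_of_ne v a hv, mul_zero]
  have hpow : ω * (e a * r * e a) ^ n = l ^ n * ω := hsemi.pow_right n
  rw [hn, mul_zero] at hpow
  have h0 := h.apply_eq_zero_of_mul_rel hs hpow.symm
  rw [map_pow] at h0
  exact eq_zero_of_pow_eq_zero h0

theorem apply_eq_zero_of_not_isSplitEpiHom [IsNoetherian R U] {X : Type u} [AddCommGroup X]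
    [Module R X] {k : X →ₗ[R] U} (hk : ¬ IsSplitEpiHom k) {q : X} (hq : ω • q = 0) {r l : R}
    (hr : r • x = k q) (hl : ω * r * e a = l * ω) : ε c l = 0 :=
  h.apply_eq_zero_of_mul_eq hs (not_not.1 fun hra =>
    hk (h.isSplitEpiHom_of_smul_eq hs hq hr hra)) hl

end Relation

end IsOneRelation

/-! ### The almost split sequence of a module with one relation -/

section Pullback

variable {R : Type*} [Ring R] {A B U X : Type*} [AddCommGroup A] [Module R A] [AddCommGroup B]
  [Module R B] [AddCommGroup U] [Module R U] [AddCommGroup X] [Module R X]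

theorem exists_mem_ne_zero_of_isArtinian [IsArtinian R B] {M : Submodule R B} (hM : M ≠ ⊥) :
    ∃ b ∈ M, b ≠ 0 ∧ ∀ j ∈ Ring.jacobson R, j • b = 0 := by
  obtain ⟨T, hT, hTM⟩ := (IsAtomic.eq_bot_or_exists_atom_le M).resolve_left hM
  obtain ⟨b, hb, hb0⟩ := Submodule.exists_mem_ne_zero_of_ne_bot hT.1
  have hspan : Submodule.span R {b} = T :=
    (hT.le_iff.1 ((Submodule.span_singleton_le_iff_mem b T).2 hb)).resolve_left
      (Submodule.span_singleton_eq_bot.not.2 hb0)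
  have hJ : Ring.jacobson R • T = ⊥ :=
    hT.2 _ (Submodule.FG.jacobson_smul_lt hT.1 (hspan ▸ Submodule.fg_span_singleton b))
  exact ⟨b, hTM hb, hb0, fun j hj => (Submodule.mem_bot R).1 (hJ ▸ Submodule.smul_mem_smul hj hb)⟩

/-- The kernel in the statement is the pullback of `g` and `k`. A retraction onto the kernel of `g`
splits the projection of the pullback to `X`. -/
theorem exists_comp_eq_of_pullback {f : A →ₗ[R] B} {g : B →ₗ[R] U} {k : X →ₗ[R] U}
    (hg : Function.Surjective g) (hgf : g ∘ₗ f = 0) (ρ : LinearMap.ker (g.coprod (-k)) →ₗ[R] A)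
    (hρ : ∀ z : LinearMap.ker (g.coprod (-k)), z.1.2 = 0 → f (ρ z) = z.1.1) :
    ∃ k' : X →ₗ[R] B, g ∘ₗ k' = k := by
  let E : Submodule R (B × X) := LinearMap.ker (g.coprod (-k))
  have hE (z : E) : g z.1.1 = k z.1.2 := by
    have hz : g z.1.1 + -k z.1.2 = 0 := z.2
    rwa [add_neg_eq_zero] at hz
  have hsurj : Function.Surjective (LinearMap.snd R B X ∘ₗ E.subtype) := fun q => by
    obtain ⟨b, hb⟩ := hg (k q)
    exact ⟨⟨(b, q), show g b + -k q = 0 by rw [hb, add_neg_cancel]⟩, rfl⟩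
  obtain ⟨k', hk'⟩ := exists_comp_eq_of_ker_le_ker hsurj
    (d := LinearMap.fst R B X ∘ₗ E.subtype - f ∘ₗ ρ) fun z hz => sub_eq_zero.2 (hρ z hz).symm
  refine ⟨k', LinearMap.ext fun q => ?_⟩
  obtain ⟨z, rfl⟩ := hsurj q
  have hz : k' z.1.2 = z.1.1 - f (ρ z) := LinearMap.congr_fun hk' z
  have hgz : g (k' z.1.2) = k z.1.2 := by
    have hfz : g (f (ρ z)) = 0 := LinearMap.congr_fun hgf (ρ z)
    rw [hz, map_sub, hfz, sub_zero, hE]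
  exact hgz

end Pullback

namespace IsOneRelation

variable {K R V : Type u} [Field K] [Ring R] [Algebra K R] [Fintype V]
  {e : V → R} {ε : V → R →ₐ[K] K} {a c : V} {ω : R}
  {U : Type u} [AddCommGroup U] [Module R U] {x : U}
  (h : IsOneRelation e a c ω x) (hs : IsSplitBasic e ε)

section Socle

/-- The character at `c`, which generates the socle of the dual of `e_c R / ω R`. -/
def socleElement : transposeDual K (e c) ω :=
  ⟨((ε c).toLinearMap : Module.Dual K R), fun y => by
    change ε c (e c * y) = ε c y ∧ ε c (ω * y) = 0
    rw [map_mul, map_mul, hs.apply_self, one_mul, h.apply_rel hs, zero_mul]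
    exact ⟨rfl, rfl⟩⟩

theorem smul_socleElement_apply (r y : R) : (r • h.socleElement hs).1 y = ε c y * ε c r :=
  map_mul (ε c) y r

theorem socleElement_apply_one : (h.socleElement hs).1 1 = 1 := map_one (ε c)

theorem socleElement_ne_zero : h.socleElement hs ≠ 0 := fun h0 =>
  zero_ne_one ((congrArg (fun b => b.1 1) h0).symm.trans (h.socleElement_apply_one hs))

theorem smul_socleElement : e c • h.socleElement hs = h.socleElement hs := by
  ext y
  rw [h.smul_socleElement_apply, hs.apply_self, mul_one]
  rfl

theorem smul_socleElement_eq_zero {r : R} (hr : ε c r = 0) : r • h.socleElement hs = 0 := by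
  ext y
  rw [h.smul_socleElement_apply, hr, mul_zero]
  rfl

theorem eq_smul_socleElement {b : transposeDual K (e c) ω}
    (hb : ∀ j ∈ Ring.jacobson R, j • b = 0) : b = algebraMap K R (b.1 1) • h.socleElement hs := by
  ext y
  have hj : e c * (y - algebraMap K R (ε c y)) ∈ Ring.jacobson R := hs.mem_jacobson.2 fun v => by
    rcases eq_or_ne v c with rfl | hv
    · rw [map_mul, map_sub, AlgHom.commutes, Algebra.algebraMap_self_apply, sub_self, mul_zero]
    · rw [map_mul, hs.apply_of_ne v c hv, zero_mul]
  have h0 : b.1 (1 * (e c * (y - algebraMap K R (ε c y)))) = 0 :=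
    congrArg (fun b : transposeDual K (e c) ω => b.1 1) (hb _ hj)
  rw [one_mul, transposeDual_apply_mul, map_sub, sub_eq_zero, Algebra.algebraMap_eq_smul_one,
    map_smul, smul_eq_mul] at h0
  rw [h0, h.smul_socleElement_apply, AlgHom.commutes, Algebra.algebraMap_self_apply]

theorem socleElement_mem [Module.Finite K R] {M : Submodule R (transposeDual K (e c) ω)}
    (hM : M ≠ ⊥) : h.socleElement hs ∈ M := by
  have := IsArtinianRing.of_finite K R
  obtain ⟨b, hb, hb0, hJ⟩ := exists_mem_ne_zero_of_isArtinian hM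
  have hbs := h.eq_smul_socleElement hs hJ
  have hb1 : b.1 1 ≠ 0 := fun h0 => hb0 (by rw [hbs, h0, map_zero, zero_smul])
  have hsb : algebraMap K R (b.1 1)⁻¹ • b = h.socleElement hs :=
    (congrArg (algebraMap K R (b.1 1)⁻¹ • ·) hbs).trans
      (by rw [← mul_smul, ← map_mul, inv_mul_cancel₀ hb1, map_one, one_smul])
  exact hsb ▸ M.smul_mem _ hb

include h hs in
theorem isUniformModule_transposeDual [Module.Finite K R] :
    IsUniformModule R (transposeDual K (e c) ω) := fun M M' hd => by
  by_contra! hne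
  exact h.socleElement_ne_zero hs
    (Submodule.disjoint_def.1 hd _ (h.socleElement_mem hs hne.1) (h.socleElement_mem hs hne.2))

end Socle

section Middle

/-- The relations of the middle term: in the quotient, the second generator is supported at the
vertex `a`, and `ω` maps it to the generator of the socle of the first summand. -/
noncomputable def middleRelations : Submodule R (transposeDual K (e c) ω × R) :=
  Submodule.span R {(-h.socleElement hs, ω), (0, 1 - e a)}

/-- The middle term of the almost split sequence that ends in the module with one relation. -/
abbrev Middle : Type u := (transposeDual K (e c) ω × R) ⧸ h.middleRelations hs

/-- The map from the first term of the almost split sequence to the middle term. -/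
noncomputable def inclusion : transposeDual K (e c) ω →ₗ[R] h.Middle hs :=
  (h.middleRelations hs).mkQ ∘ₗ LinearMap.inl R _ _

/-- The element of the middle term that is mapped to the generator of the last term. -/
noncomputable def middleGen : h.Middle hs := (h.middleRelations hs).mkQ (0, 1)

theorem middleRelations_le_ker {X : Type*} [AddCommGroup X] [Module R X]
    {k : transposeDual K (e c) ω →ₗ[R] X} {q : X} (hq : ω • q = k (h.socleElement hs)) :
    h.middleRelations hs ≤
      LinearMap.ker (k.coprod (LinearMap.toSpanSingleton R X (e a • q))) := by
  rw [middleRelations, Submodule.span_le]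
  rintro _ (rfl | rfl)
  · rw [SetLike.mem_coe, LinearMap.mem_ker, LinearMap.coprod_apply, map_neg,
      LinearMap.toSpanSingleton_apply, ← mul_smul, (h.rel_mem hs).2, hq, neg_add_cancel]
  · rw [SetLike.mem_coe, LinearMap.mem_ker, LinearMap.coprod_apply, map_zero, zero_add,
      LinearMap.toSpanSingleton_apply, ← mul_smul, sub_mul, one_mul, hs.isIdempotentElem a,
      sub_self, zero_smul]

/-- The map from the middle term to the last term of the almost split sequence. -/
noncomputable def projection : h.Middle hs →ₗ[R] U :=
  (h.middleRelations hs).liftQ ((0 : transposeDual K (e c) ω →ₗ[R] U).coprod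
    (LinearMap.toSpanSingleton R U (e a • x)))
    (h.middleRelations_le_ker hs (h.rel_mem hs).1)

theorem exists_comp_inclusion_eq {X : Type*} [AddCommGroup X] [Module R X]
    {k : transposeDual K (e c) ω →ₗ[R] X} {q : X} (hq : ω • q = k (h.socleElement hs)) :
    ∃ k' : h.Middle hs →ₗ[R] X, k' ∘ₗ h.inclusion hs = k :=
  ⟨(h.middleRelations hs).liftQ _ (h.middleRelations_le_ker hs hq), by
    rw [inclusion, ← LinearMap.comp_assoc, Submodule.liftQ_mkQ, LinearMap.coprod_inl]⟩

theorem mkQ_eq (z : transposeDual K (e c) ω × R) :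
    (h.middleRelations hs).mkQ z = h.inclusion hs z.1 + z.2 • h.middleGen hs := by
  rw [inclusion, middleGen, LinearMap.comp_apply, LinearMap.inl_apply, ← map_smul, ← map_add,
    Prod.smul_mk, smul_zero, smul_eq_mul, mul_one, Prod.mk_add_mk, add_zero, zero_add]

theorem exists_eq_inclusion_add (m : h.Middle hs) :
    ∃ (b : transposeDual K (e c) ω) (r : R), m = h.inclusion hs b + r • h.middleGen hs := by
  obtain ⟨z, rfl⟩ := (h.middleRelations hs).mkQ_surjective m
  exact ⟨z.1, z.2, h.mkQ_eq hs z⟩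

theorem exists_of_inclusion_add_eq_zero {b : transposeDual K (e c) ω} {r : R}
    (h0 : h.inclusion hs b + r • h.middleGen hs = 0) :
    ∃ l : R, b = -(l • h.socleElement hs) ∧ r * e a = l * ω := by
  have hmem : (b, r) ∈ h.middleRelations hs :=
    (Submodule.Quotient.mk_eq_zero _).1 ((h.mkQ_eq hs (b, r)).trans h0)
  obtain ⟨l, t, hlt⟩ := Submodule.mem_span_pair.1 hmem
  rw [Prod.smul_mk, Prod.smul_mk, Prod.mk_add_mk, Prod.mk.injEq] at hlt
  obtain ⟨rfl, rfl⟩ := hlt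
  refine ⟨l, by rw [smul_zero, add_zero, smul_neg], ?_⟩
  rw [smul_eq_mul, smul_eq_mul, add_mul, mul_assoc, (h.rel_mem hs).2, mul_assoc, sub_mul, one_mul,
    hs.isIdempotentElem a, sub_self, mul_zero, add_zero]

theorem smul_middleGen : e a • h.middleGen hs = h.middleGen hs := by
  have h0 : (h.middleRelations hs).mkQ (0, 1 - e a) = 0 :=
    (Submodule.Quotient.mk_eq_zero _).2 (Submodule.subset_span (by simp))
  rw [h.mkQ_eq, map_zero, zero_add, sub_smul, one_smul, sub_eq_zero] at h0
  exact h0.symm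

theorem rel_smul_middleGen : ω • h.middleGen hs = h.inclusion hs (h.socleElement hs) := by
  have h0 : (h.middleRelations hs).mkQ (-h.socleElement hs, ω) = 0 :=
    (Submodule.Quotient.mk_eq_zero _).2 (Submodule.subset_span (by simp))
  rwa [h.mkQ_eq, map_neg, neg_add_eq_zero, eq_comm] at h0

theorem projection_comp_inclusion : h.projection hs ∘ₗ h.inclusion hs = 0 := by
  rw [projection, inclusion, ← LinearMap.comp_assoc, Submodule.liftQ_mkQ, LinearMap.coprod_inl]

theorem projection_inclusion_add (b : transposeDual K (e c) ω) (r : R) :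
    h.projection hs (h.inclusion hs b + r • h.middleGen hs) = r • x := by
  rw [← h.mkQ_eq hs (b, r), projection, Submodule.mkQ_apply, Submodule.liftQ_apply,
    LinearMap.coprod_apply, LinearMap.zero_apply, zero_add, LinearMap.toSpanSingleton_apply,
    h.smul_self]

theorem injective_inclusion : Function.Injective (h.inclusion hs) := by
  refine (injective_iff_map_eq_zero _).2 fun b hb => ?_
  obtain ⟨l, rfl, hl⟩ := h.exists_of_inclusion_add_eq_zero hs (b := b) (r := 0)
    (by rw [hb, zero_smul, add_zero])
  rw [zero_mul] at hl
  rw [h.smul_socleElement_eq_zero hs (h.apply_eq_zero_of_mul_rel hs hl.symm), neg_zero]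

theorem surjective_projection : Function.Surjective (h.projection hs) := fun y => by
  obtain ⟨r, rfl⟩ := exists_smul_eq_of_span_eq_top h.span_eq_top y
  exact ⟨_, h.projection_inclusion_add hs 0 r⟩

theorem exact_inclusion_projection : Function.Exact (h.inclusion hs) (h.projection hs) := by
  refine LinearMap.exact_iff.2 (le_antisymm (fun m hm => ?_)
    (LinearMap.range_le_ker_iff.2 (h.projection_comp_inclusion hs)))
  obtain ⟨b, r, rfl⟩ := h.exists_eq_inclusion_add hs m
  rw [LinearMap.mem_ker, projection_inclusion_add] at hm
  obtain ⟨l, hl⟩ := h.exists_mul_rel hs hm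
  refine ⟨b + l • h.socleElement hs, ?_⟩
  rw [map_add, map_smul, ← h.rel_smul_middleGen hs, ← mul_smul, hl, mul_smul, h.smul_middleGen]

theorem not_isSplitMonoHom_inclusion : ¬ IsSplitMonoHom (h.inclusion hs) := by
  rintro ⟨ρ, hρ⟩
  have hω : ω • ρ (h.middleGen hs) = h.socleElement hs := by
    rw [← map_smul, h.rel_smul_middleGen]
    exact LinearMap.congr_fun hρ _
  have h1 : (h.socleElement hs).1 1 = 0 := by
    rw [← hω, Submodule.coe_smul, DualModule.smul_apply, one_mul, transposeDual_apply_rel]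
  exact one_ne_zero ((h.socleElement_apply_one hs).symm.trans h1)

theorem not_isSplitEpiHom_projection : ¬ IsSplitEpiHom (h.projection hs) := fun hsplit =>
  h.not_isSplitMonoHom_inclusion hs
    ((((h.exact_inclusion_projection hs).split_tfae (h.injective_inclusion hs)
      (h.surjective_projection hs)).out 0 1).1 hsplit)

/-- If `ω q` were never the image of the generator of the socle, a homomorphism from `X` to the dual
would be nonzero on that image, so its composition with `k` would be an automorphism. -/
theorem isLeftAlmostSplit_inclusion [Module.Finite K R] : IsLeftAlmostSplit (h.inclusion hs) := by
  have := IsArtinianRing.of_finite K R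
  refine ⟨h.not_isSplitMonoHom_inclusion hs, fun X _ _ _ k hk => ?_⟩
  obtain ⟨q, hq⟩ : ∃ q : X, ω • q = k (h.socleElement hs) := by
    by_contra! hq
    obtain ⟨ρ, hρ⟩ := exists_hom_apply_ne_zero K (hs.isIdempotentElem c) h.left_mul
      (by rw [← map_smul, h.smul_socleElement]) hq
    have hinj : Function.Injective (ρ ∘ₗ k) := LinearMap.ker_eq_bot.1 (by
      by_contra hker
      exact hρ (h.socleElement_mem hs hker))
    let E := LinearEquiv.ofBijective _ (IsArtinian.bijective_of_injective_endomorphism _ hinj)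
    exact hk ⟨E.symm.toLinearMap ∘ₗ ρ, LinearMap.ext E.symm_apply_apply⟩
  exact h.exists_comp_inclusion_eq hs hq

theorem apply_one_eq_zero_of_rel_smul_eq [IsNoetherian R U] {X : Type u} [AddCommGroup X]
    [Module R X] {k : X →ₗ[R] U} (hk : ¬ IsSplitEpiHom k) {m : h.Middle hs} {q : X}
    (hmq : h.projection hs m = k q) (hq : ω • q = 0) {b : transposeDual K (e c) ω}
    (hm : ω • m = h.inclusion hs b) : b.1 1 = 0 := by
  obtain ⟨b', r, rfl⟩ := h.exists_eq_inclusion_add hs m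
  rw [projection_inclusion_add] at hmq
  have h0 : h.inclusion hs (ω • b' - b) + (ω * r) • h.middleGen hs = 0 := by
    rw [map_sub, map_smul, mul_smul, sub_add_eq_add_sub, ← smul_add, hm, sub_self]
  obtain ⟨l, hb, hl⟩ := h.exists_of_inclusion_add_eq_zero hs h0
  rw [h.smul_socleElement_eq_zero hs (h.apply_eq_zero_of_not_isSplitEpiHom hs hk hq hmq hl),
    neg_zero, sub_eq_zero] at hb
  rw [← hb, Submodule.coe_smul, DualModule.smul_apply, one_mul, transposeDual_apply_rel]

theorem isRightAlmostSplit_projection [IsNoetherian R U] :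
    IsRightAlmostSplit (h.projection hs) := by
  refine ⟨h.not_isSplitEpiHom_projection hs, fun X _ _ _ k hk => ?_⟩
  have hgf := h.projection_comp_inclusion hs
  let E : Submodule R (h.Middle hs × X) := LinearMap.ker ((h.projection hs).coprod (-k))
  let ι : transposeDual K (e c) ω →ₗ[R] E :=
    (LinearMap.inl R _ X ∘ₗ h.inclusion hs).codRestrict E fun b => by
      have hb : h.projection hs (h.inclusion hs b) = 0 := LinearMap.congr_fun hgf b
      rw [LinearMap.mem_ker, LinearMap.comp_apply, LinearMap.inl_apply, LinearMap.coprod_apply, hb,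
        map_zero, add_zero]
  obtain ⟨ρ, hρ⟩ := exists_comp_eq_id_of_smul_eq (hs.isIdempotentElem c) h.left_mul ι
    fun z b hz => by
      have hz0 : h.projection hs z.1.1 + -k z.1.2 = 0 := z.2
      exact h.apply_one_eq_zero_of_rel_smul_eq hs hk (add_neg_eq_zero.1 hz0)
        (congrArg (fun z : E => z.1.2) hz) (congrArg (fun z : E => z.1.1) hz)
  refine exists_comp_eq_of_pullback (h.surjective_projection hs) hgf ρ fun z hz => ?_
  have hz0 : h.projection hs z.1.1 + -k z.1.2 = 0 := z.2
  rw [hz, map_zero, neg_zero, add_zero] at hz0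
  obtain ⟨b, hb⟩ := (h.exact_inclusion_projection hs _).1 hz0
  obtain rfl : ι b = z := Subtype.ext (Prod.ext hb hz.symm)
  exact (congrArg (h.inclusion hs) (LinearMap.congr_fun hρ b)).trans hb

theorem isAlmostSplitSequence [Module.Finite K R] [IsNoetherian R U] :
    IsAlmostSplitSequence (h.inclusion hs) (h.projection hs) where
  injective := h.injective_inclusion hs
  exact := h.exact_inclusion_projection hs
  surjective := h.surjective_projection hs
  leftAlmostSplit := h.isLeftAlmostSplit_inclusion hs
  rightAlmostSplit := h.isRightAlmostSplit_projection hs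

end Middle

include h hs in
open Classical in
theorem alphaEq_ite [Module.Finite K R] [IsNoetherian R U]
    (hU : ∀ N N' : Submodule R U, N ≤ N' ∨ N' ≤ N) :
    AlphaEq R U
      (if IsIrreducibleHom (Ring.jacobson R • (⊤ : Submodule R U)).subtype then 2 else 1) := by
  have := IsArtinianRing.of_finite K R
  have : Nontrivial U := ⟨⟨x, 0, h.gen_ne_zero⟩⟩
  exact (h.isAlmostSplitSequence hs).alphaEq_ite (h.isUniformModule_transposeDual hs) hU
    (hs.isGreatest_jacobson_smul_top hU)

end IsOneRelation

/-! ### Relations of a uniserial module -/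

section Chain

variable {R : Type u} [Ring R]

theorem le_total_coe_iff {N : Type*} [AddCommGroup N] [Module R N] (P : Submodule R N) :
    (∀ Q Q' : Submodule R P, Q ≤ Q' ∨ Q' ≤ Q) ↔ ∀ L ≤ P, ∀ L' ≤ P, L ≤ L' ∨ L' ≤ L :=
  ⟨fun h L hL L' hL' => (h (P.mapIic.symm ⟨L, hL⟩) (P.mapIic.symm ⟨L', hL'⟩)).imp
      P.mapIic.symm.le_iff_le.1 P.mapIic.symm.le_iff_le.1,
    fun h Q Q' => (h _ (P.mapIic Q).2 _ (P.mapIic Q').2).imp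
      P.mapIic.le_iff_le.1 P.mapIic.le_iff_le.1⟩

theorem mem_radicalMul {f r : R} : r ∈ radicalMul R f ↔ ∃ j ∈ Ring.jacobson R, j * f = r := by
  have h : radicalMul R f = Submodule.map (LinearMap.toSpanSingleton R R f) (Ring.jacobson R) :=
    -- `radicalMul` elaborates to `Ideal.map`, the ideal spanned by the image.
    Submodule.span_eq (Submodule.map (LinearMap.toSpanSingleton R R f) (Ring.jacobson R))
  rw [h]
  exact Iff.rfl

theorem mul_eq_of_mem_radicalMul {f r : R} (hf : IsIdempotentElem f) (hr : r ∈ radicalMul R f) :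
    r * f = r := by
  obtain ⟨j, -, rfl⟩ := mem_radicalMul.1 hr
  rw [mul_assoc, hf]

/-- A factorization of the inclusion of `M` through the pushout of `R ← R → M`, with the maps given
by `p` and `p x`: irreducibility splits one of the two factors. -/
theorem IsIrreducibleHom.exists_smul_eq_or_exists_mul_eq {U : Type u} [AddCommGroup U] [Module R U]
    {M : Submodule R U} [Module.Finite R M] (hirr : IsIrreducibleHom M.subtype) {p : R} {x : U}
    (hpx : p • x ∈ M) : (∃ y ∈ M, p • y = p • x) ∨
      ∃ r : R, ∃ u ∈ M, r • x + u = x ∧ ∀ s : R, s • x = 0 → ∃ t : R, t * p = s * r := by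
  let S : Submodule R (R × M) := Submodule.span R {(p, -⟨p • x, hpx⟩)}
  let k : M →ₗ[R] (R × M) ⧸ S := S.mkQ ∘ₗ LinearMap.inr R R M
  let l : (R × M) ⧸ S →ₗ[R] U :=
    S.liftQ ((LinearMap.toSpanSingleton R U x).coprod M.subtype) (by
      rw [Submodule.span_singleton_le_iff_mem]
      exact add_neg_cancel (p • x))
  have hlk : l ∘ₗ k = M.subtype := by
    rw [← LinearMap.comp_assoc, Submodule.liftQ_mkQ, LinearMap.coprod_inr]
  rcases hirr.2.2 _ k l hlk with ⟨ρ, hρ⟩ | ⟨σ, hσ⟩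
  · left
    have hk : p • S.mkQ (1, 0) = k ⟨p • x, hpx⟩ := by
      refine (Submodule.Quotient.eq S).2 (Submodule.mem_span_singleton.2 ⟨1, ?_⟩)
      change (1 : R) • (p, -⟨p • x, hpx⟩) = p • ((1, 0) : R × M) - (0, ⟨p • x, hpx⟩)
      rw [one_smul, Prod.smul_mk, smul_zero, smul_eq_mul, mul_one, Prod.mk_sub_mk, sub_zero,
        zero_sub]
    refine ⟨ρ (S.mkQ (1, 0)), (ρ (S.mkQ (1, 0))).2, ?_⟩
    rw [← Submodule.coe_smul, ← map_smul, hk]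
    exact congrArg Subtype.val (LinearMap.congr_fun hρ ⟨p • x, hpx⟩)
  · right
    obtain ⟨⟨r, u⟩, hru⟩ := S.mkQ_surjective (σ x)
    refine ⟨r, u, u.2, (congrArg l hru).trans (LinearMap.congr_fun hσ x), fun s hs => ?_⟩
    have hmem : s • (r, u) ∈ S := by
      rw [← Submodule.Quotient.mk_eq_zero, ← Submodule.mkQ_apply, map_smul, hru, ← map_smul, hs,
        map_zero]
    obtain ⟨t, ht⟩ := Submodule.mem_span_singleton.1 hmem
    exact ⟨t, congrArg Prod.fst ht⟩

end Chain

namespace IsSplitBasic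

variable {K R V : Type u} [Field K] [Ring R] [Algebra K R] [Fintype V]
  {e : V → R} {ε : V → R →ₐ[K] K} (hs : IsSplitBasic e ε)

section CyclicSubmodule

variable {N : Type*} [AddCommGroup N] [Module R N]

include hs

/-- Otherwise every summand lies in the radical of the cyclic module, against Nakayama's lemma. -/
theorem exists_mem_of_span_eq_iSup {ι : Sort*} {W : ι → Submodule R N} {v : V} {y : N}
    (hy : e v • y = y) (hy0 : y ≠ 0) (hW : Submodule.span R {y} = ⨆ i, W i) : ∃ i, y ∈ W i := by
  by_contra! hyW
  have hle : Submodule.span R {y} ≤ Ring.jacobson R • Submodule.span R {y} := by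
    conv_lhs => rw [hW]
    refine iSup_le fun i z hz => ?_
    obtain ⟨j, hj, rfl⟩ := hs.exists_mem_jacobson_of_mem_span hy (hyW i) hz
      (hW ▸ Submodule.mem_iSup_of_mem i hz)
    exact Submodule.smul_mem_smul hj (Submodule.mem_span_singleton_self y)
  exact hy0 (Submodule.span_singleton_eq_bot.1
    (Submodule.FG.eq_bot_of_le_jacobson_smul (Submodule.fg_span_singleton y) hle))

theorem le_total_of_span_eq_iSup {ι : Sort*} {W : ι → Submodule R N} {v : V} {y : N}
    (hy : e v • y = y) (hW : ∀ i, ∀ Q Q' : Submodule R (W i), Q ≤ Q' ∨ Q' ≤ Q)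
    (hsup : Submodule.span R {y} = ⨆ i, W i) :
    ∀ L ≤ Submodule.span R {y}, ∀ L' ≤ Submodule.span R {y}, L ≤ L' ∨ L' ≤ L := by
  intro L hL L' hL'
  rcases eq_or_ne y 0 with rfl | hy0
  · rw [Submodule.span_zero_singleton] at hL
    exact Or.inl (hL.trans bot_le)
  · obtain ⟨i, hi⟩ := hs.exists_mem_of_span_eq_iSup hy hy0 hsup
    have hle := (Submodule.span_singleton_le_iff_mem y (W i)).2 hi
    exact (le_total_coe_iff (W i)).1 (hW i) L (hL.trans hle) L' (hL'.trans hle)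

theorem inf_le_span_of_mem_sup {Z W : Submodule R N} {z p : N} {v : V}
    (hW : ∀ Q Q' : Submodule R W, Q ≤ Q' ∨ Q' ≤ Q) (hz : z ∈ Z) (hvp : e v • p = p)
    (hpZ : p ∉ Z) (hpW : p ∈ W ⊔ Submodule.span R {z}) (hJp : ∀ j ∈ Ring.jacobson R, j • p = 0) :
    Z ⊓ W ≤ Submodule.span R {z} := by
  obtain ⟨q, hq, _, hz', hqp⟩ := Submodule.mem_sup.1 hpW
  obtain ⟨t, rfl⟩ := Submodule.mem_span_singleton.1 hz'
  have hvq : e v • q = p - (e v * t) • z := by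
    rw [mul_smul, eq_sub_iff_add_eq, ← smul_add, hqp, hvp]
  have hqZ : e v • q ∉ Z := fun h => hpZ (by
    rw [hvq] at h
    exact (Z.sub_mem_iff_left (Z.smul_mem _ hz)).1 h)
  have hqW := (Submodule.span_singleton_le_iff_mem (e v • q) W).2 (W.smul_mem _ hq)
  intro y hy
  rcases (le_total_coe_iff W).1 hW (Z ⊓ W) inf_le_right _ hqW with hle | hle
  · obtain ⟨j, hj, rfl⟩ := hs.exists_mem_jacobson_of_mem_span
      (by rw [smul_smul, hs.isIdempotentElem v]) hqZ hy.1 (hle hy)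
    rw [hvq, smul_sub, hJp j hj, zero_sub, smul_smul]
    exact neg_mem (Submodule.smul_mem _ _ (Submodule.mem_span_singleton_self z))
  · exact absurd (hle (Submodule.mem_span_singleton_self _)).1 hqZ

theorem eq_span_of_le_sup {Z W : Submodule R N} {z p : N} {v : V}
    (hW : ∀ Q Q' : Submodule R W, Q ≤ Q' ∨ Q' ≤ Q) (hz : z ∈ Z) (hvp : e v • p = p)
    (hpZ : p ∉ Z) (hpW : p ∈ W ⊔ Submodule.span R {z}) (hJp : ∀ j ∈ Ring.jacobson R, j • p = 0)
    (hZ : Z ≤ W ⊔ Submodule.span R {z}) : Z = Submodule.span R {z} := by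
  have hzZ : Submodule.span R {z} ≤ Z := (Submodule.span_singleton_le_iff_mem z Z).2 hz
  refine le_antisymm ?_ hzZ
  calc Z = (Submodule.span R {z} ⊔ W) ⊓ Z := (inf_eq_right.2 (sup_comm W _ ▸ hZ)).symm
    _ = Submodule.span R {z} ⊔ W ⊓ Z := sup_inf_assoc_of_le W hzZ
    _ ≤ Submodule.span R {z} := sup_le le_rfl
        (inf_comm Z W ▸ hs.inf_le_span_of_mem_sup hW hz hvp hpZ hpW hJp)

theorem exists_sup_eq_sup_span [IsNoetherian R N] [Nonempty V] {U : Type*} [AddCommGroup U]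
    [Module R U] {φ : N →ₗ[R] U} {W W' : Submodule R N}
    (hW' : ∀ Q Q' : Submodule R W', Q ≤ Q' ∨ Q' ≤ Q) (hle : W'.map φ ≤ W.map φ) :
    ∃ (v : V) (z : N), e v • z = z ∧ φ z = 0 ∧ W ⊔ W' = W ⊔ Submodule.span R {z} := by
  obtain ⟨v, w', hvw', rfl⟩ := hs.exists_eq_span W' hW'
  obtain ⟨w, hw, hφ⟩ := hle ⟨w', Submodule.mem_span_singleton_self w', rfl⟩
  have hvw : e v • w ∈ W := W.smul_mem _ hw
  refine ⟨v, w' - e v • w, ?_, ?_, le_antisymm (sup_le le_sup_left ?_) (sup_le le_sup_left ?_)⟩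
  · rw [smul_sub, hvw', smul_smul, hs.isIdempotentElem v]
  · rw [map_sub, map_smul, hφ, ← map_smul, hvw', sub_self]
  · have hadd := add_mem (Submodule.mem_sup_right (Submodule.mem_span_singleton_self
      (w' - e v • w))) (Submodule.mem_sup_left hvw)
    rwa [sub_add_cancel, ← Submodule.span_singleton_le_iff_mem] at hadd
  · rw [Submodule.span_singleton_le_iff_mem]
    exact sub_mem (Submodule.mem_sup_right (Submodule.mem_span_singleton_self _))
      (Submodule.mem_sup_left hvw)

end CyclicSubmodule

section Relation

variable {U : Type u} [AddCommGroup U] [Module R U] {a : V} {x : U}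

include hs

theorem relationModule_le_radicalMul (hxa : e a • x = x) (hx : x ≠ 0) :
    relationModule (e a) x ≤ radicalMul R (e a) := fun r hr => by
  obtain ⟨hrx, hra⟩ := (mem_relationModule (hs.isIdempotentElem a)).1 hr
  refine mem_radicalMul.2 ⟨r, ?_, hra⟩
  rw [← hra]
  refine hs.mul_mem_jacobson (not_not.1 fun hr0 => hx ?_)
  exact (Submodule.mem_bot R).1 (hs.mem_of_smul_mem hr0 hxa ((Submodule.mem_bot R).2 hrx))

theorem mem_radicalMul_of_jacobson_mul_eq_zero {p : R} (hpa : p * e a = p)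
    (hJp : ∀ j ∈ Ring.jacobson R, j * p = 0) (hJ : radicalMul R (e a) ≠ ⊥) :
    p ∈ radicalMul R (e a) := by
  refine mem_radicalMul.2 ⟨p, ?_, hpa⟩
  rw [← hpa]
  refine hs.mul_mem_jacobson (not_not.1 fun hp0 => hJ ((Submodule.eq_bot_iff _).2 fun y hy => ?_))
  obtain ⟨j, hj, rfl⟩ := mem_radicalMul.1 hy
  obtain ⟨s, hsp⟩ := hs.exists_mul_mul_eq hp0
  rw [← hsp, mul_assoc s, hpa, ← mul_assoc]
  exact hJp _ (Ideal.mul_mem_right s _ hj)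

variable (hxa : e a • x = x) (hspan : Submodule.span R {x} = ⊤) (hU : ¬ Module.Projective R U)

include hxa hspan hU

theorem isOneRelation_of_relationModule_eq {c : V} {ω : R} (hω : e c * ω = ω)
    (hrel : relationModule (e a) x = Submodule.span R {ω}) : IsOneRelation e a c ω x where
  smul_self := hxa
  span_eq_top := hspan
  gen_ne_zero := ne_zero_of_not_projective hspan hU
  left_mul := hω
  rel_ne_zero := Submodule.span_singleton_eq_bot.not.1
    (hrel ▸ relationModule_ne_bot (hs.isIdempotentElem a) hxa hspan hU)
  relationModule_eq := hrel

theorem radicalMul_ne_bot : radicalMul R (e a) ≠ ⊥ := fun hbot =>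
  relationModule_ne_bot (hs.isIdempotentElem a) hxa hspan hU (le_bot_iff.1
    (hbot ▸ hs.relationModule_le_radicalMul hxa (ne_zero_of_not_projective hspan hU)))

variable [IsNoetherianRing R]

theorem exists_isOneRelation_of_chain
    (hJ : ∀ L ≤ radicalMul R (e a), ∀ L' ≤ radicalMul R (e a), L ≤ L' ∨ L' ≤ L) :
    ∃ c ω, IsOneRelation e a c ω x := by
  have : Nonempty V := ⟨a⟩
  have hle := hs.relationModule_le_radicalMul hxa (ne_zero_of_not_projective hspan hU)
  obtain ⟨c, ω, hω, hrel⟩ := hs.exists_eq_span (relationModule (e a) x)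
    ((le_total_coe_iff _).2 fun L hL L' hL' => hJ L (hL.trans hle) L' (hL'.trans hle))
  exact ⟨c, ω, hs.isOneRelation_of_relationModule_eq hxa hspan hU hω hrel⟩

/-- The images of the two summands in `U` are comparable, so a generator of one of them can be
corrected to a relation `ω`; as `J p = 0`, the other summand contains no relation outside `R ω`. -/
theorem exists_isOneRelation_of_sup (hchain : ∀ N N' : Submodule R U, N ≤ N' ∨ N' ≤ N)
    {W W' : Submodule R R} (hW : ∀ Q Q' : Submodule R W, Q ≤ Q' ∨ Q' ≤ Q)
    (hW' : ∀ Q Q' : Submodule R W', Q ≤ Q' ∨ Q' ≤ Q) (hsup : radicalMul R (e a) = W ⊔ W')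
    {b : V} {p : R} (hbp : e b * p = p) (hp : p ∈ radicalMul R (e a)) (hpx : p • x ≠ 0)
    (hJp : ∀ j ∈ Ring.jacobson R, j * p = 0) : ∃ c ω, IsOneRelation e a c ω x := by
  have hf := hs.isIdempotentElem a
  have : Nonempty V := ⟨a⟩
  wlog hle : W'.map (LinearMap.toSpanSingleton R U x) ≤ W.map (LinearMap.toSpanSingleton R U x)
    generalizing W W'
  · exact this hW' hW (hsup.trans (sup_comm W W')) ((hchain _ _).resolve_left hle)
  obtain ⟨c, ω, hω, hωx, hWω⟩ := hs.exists_sup_eq_sup_span hW' hle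
  rw [hWω] at hsup
  have hωmem : ω ∈ radicalMul R (e a) :=
    hsup ▸ Submodule.mem_sup_right (Submodule.mem_span_singleton_self ω)
  refine ⟨c, ω, hs.isOneRelation_of_relationModule_eq hxa hspan hU hω ?_⟩
  exact hs.eq_span_of_le_sup hW
    ((mem_relationModule hf).2 ⟨hωx, mul_eq_of_mem_radicalMul hf hωmem⟩) hbp
    (fun h => hpx ((mem_relationModule hf).1 h).1) (hsup ▸ hp) hJp
    (hsup ▸ hs.relationModule_le_radicalMul hxa (ne_zero_of_not_projective hspan hU))

end Relation

section Character

include hs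

theorem exists_unit_mul_eq {r : R} {v : V} (hr : ε v r ≠ 0) :
    ∃ u : Rˣ, e v * u = e v * r * e v := by
  have hj := hs.mul_sub_smul_mem_jacobson (e v * r) v
  rw [map_mul, hs.apply_self, one_mul] at hj
  obtain ⟨u, hu⟩ := hs.isUnit_algebraMap_add hr hj
  refine ⟨u, ?_⟩
  rw [hu, mul_add, mul_sub, mul_smul_comm, ← mul_assoc, ← mul_assoc, hs.isIdempotentElem v,
    ← Algebra.commutes, ← Algebra.smul_def, add_sub_cancel]

theorem mul_eq_smul_of_jacobson_mul_eq_zero {b : V} {p : R} (hbp : e b * p = p)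
    (hJp : ∀ j ∈ Ring.jacobson R, j * p = 0) (t : R) : t * p = algebraMap K R (ε b t) * p := by
  have hj := hJp _ (hs.mul_sub_smul_mem_jacobson t b)
  rwa [sub_mul, mul_assoc, hbp, smul_mul_assoc, hbp, sub_eq_zero, Algebra.smul_def] at hj

theorem smul_smul_eq_of_smul_jacobson_eq_zero {U : Type*} [AddCommGroup U] [Module R U] {a : V}
    {x : U} (hxa : e a • x = x) {p : R}
    (hp : ∀ y ∈ Ring.jacobson R • (⊤ : Submodule R U), p • y = 0) (r : R) :
    p • r • x = algebraMap K R (ε a r) • p • x := by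
  have hj := hp _ (Submodule.smul_mem_smul (hs.mul_sub_smul_mem_jacobson r a)
    (Submodule.mem_top (x := x)))
  rw [sub_smul, mul_smul, hxa, Algebra.smul_def, mul_smul, hxa, smul_sub, sub_eq_zero] at hj
  rw [hj, smul_smul, ← Algebra.commutes, mul_smul]

end Character

end IsSplitBasic

namespace IsOneRelation

variable {K R V : Type u} [Field K] [Ring R] [Algebra K R] [Fintype V]
  {e : V → R} {ε : V → R →ₐ[K] K} {a c : V} {ω : R}
  {U : Type u} [AddCommGroup U] [Module R U] {x : U}
  (h : IsOneRelation e a c ω x) (hs : IsSplitBasic e ε)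

include h hs

/-- Otherwise `ω = c p u⁻¹` for a unit `u`, and `ω x = 0` forces `c = 0`. -/
theorem mul_ne_algebraMap_mul {p : R} (hpa : p * e a = p) (hpx : p • x ≠ 0)
    (hp : ∀ y ∈ Ring.jacobson R • (⊤ : Submodule R U), p • y = 0) {r : R} (hr : ε a r ≠ 0)
    (c : K) : ω * r ≠ algebraMap K R c * p := by
  intro hω
  obtain ⟨hωx, hωa⟩ := h.rel_mem hs
  obtain ⟨u, hu⟩ := hs.exists_unit_mul_eq hr
  have hωu : ω * u = algebraMap K R c * p := by
    rw [← hωa, mul_assoc, hu, ← mul_assoc, ← mul_assoc, hωa, hω, mul_assoc, hpa]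
  have hu0 : ε a (↑u⁻¹ : R) ≠ 0 := (u⁻¹.isUnit.map (ε a)).ne_zero
  have hc : algebraMap K R (c * ε a (↑u⁻¹ : R)) • p • x = 0 := by
    rw [map_mul, mul_smul, ← hs.smul_smul_eq_of_smul_jacobson_eq_zero h.smul_self hp, ← mul_smul,
      ← hωu, ← mul_smul, Units.mul_inv_cancel_right, hωx]
  have hc0 : c = 0 := by
    by_contra hc0
    exact hpx (((IsUnit.mk0 _ (mul_ne_zero hc0 hu0)).map (algebraMap K R)).smul_eq_zero.1 hc)
  rw [hc0, map_zero, zero_mul] at hωu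
  exact h.rel_ne_zero (u.isUnit.mul_left_eq_zero.1 hωu)

theorem not_isIrreducibleHom_subtype [IsNoetherianRing R] {b : V} {p : R} (hbp : e b * p = p)
    (hp : p ∈ radicalMul R (e a)) (hpx : p • x ≠ 0) (hJp : ∀ j ∈ Ring.jacobson R, j * p = 0)
    (hpJ : ∀ y ∈ Ring.jacobson R • (⊤ : Submodule R U), p • y = 0) :
    ¬ IsIrreducibleHom (Ring.jacobson R • (⊤ : Submodule R U)).subtype := by
  intro hirr
  have : Module.Finite R U := ⟨⟨{x}, by rw [Finset.coe_singleton, h.span_eq_top]⟩⟩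
  have hpM : p • x ∈ Ring.jacobson R • (⊤ : Submodule R U) := by
    obtain ⟨j, hj, rfl⟩ := mem_radicalMul.1 hp
    rw [mul_smul, h.smul_self]
    exact Submodule.smul_mem_smul hj Submodule.mem_top
  rcases hirr.exists_smul_eq_or_exists_mul_eq hpM with ⟨y, hy, hyx⟩ | ⟨r, u, hu, hru, hrel⟩
  · exact hpx (hyx.symm.trans (hpJ y hy))
  · obtain ⟨t, ht⟩ := hrel ω (h.rel_mem hs).1
    have hr : ε a r ≠ 0 := fun hr => hpx (by
      rw [← hru, smul_add, hpJ u hu, add_zero,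
        hs.smul_smul_eq_of_smul_jacobson_eq_zero h.smul_self hpJ, hr, map_zero, zero_smul])
    exact h.mul_ne_algebraMap_mul hs (mul_eq_of_mem_radicalMul (hs.isIdempotentElem a) hp) hpx hpJ
      hr (ε b t) (ht.symm.trans (hs.mul_eq_smul_of_jacobson_mul_eq_zero hbp hJp t))

variable [Module.Finite K R] [IsNoetherian R U] (hU : ∀ N N' : Submodule R U, N ≤ N' ∨ N' ≤ N)

include hU

theorem alphaLE_two : AlphaLE R U 2 := by
  classical
  exact ⟨_, by split_ifs <;> decide, h.alphaEq_ite hs hU⟩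

theorem alphaEq_one
    (hirr : ¬ IsIrreducibleHom (Ring.jacobson R • (⊤ : Submodule R U)).subtype) :
    AlphaEq R U 1 := by
  classical
  simpa only [if_neg hirr] using h.alphaEq_ite hs hU

end IsOneRelation

/-! ### Quotients of path algebras by admissible ideals -/

theorem jacobson_pow_smul_eq_bot {R : Type*} [Ring R] {M : Type*} [AddCommGroup M] [Module R M]
    {n : ℕ} (hn : Module.length R M ≤ n) : Ring.jacobson R ^ n • (⊤ : Submodule R M) = ⊥ := by
  induction n generalizing M with
  | zero =>
    have : Subsingleton M := Module.length_eq_zero_iff.1 (nonpos_iff_eq_zero.1 hn)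
    exact Subsingleton.elim _ _
  | succ n ih =>
    rcases subsingleton_or_nontrivial M with _ | _
    · exact Subsingleton.elim _ _
    have hfin : IsFiniteLength R M :=
      Module.length_ne_top_iff.1 (ne_top_of_le_ne_top (ENat.natCast_ne_top _) hn)
    obtain ⟨_, _⟩ := isFiniteLength_iff_isNoetherian_isArtinian.1 hfin
    set N : Submodule R M := Ring.jacobson R • ⊤ with hN
    have hlt : Module.length R N < n + 1 :=
      (Submodule.length_lt (Submodule.jacobson_smul_lt_top ⊤).ne).trans_le (by exact_mod_cast hn)
    have hbot := congrArg (Submodule.map N.subtype) (ih (Order.le_of_lt_add_one hlt))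
    rwa [Submodule.map_smul'', Submodule.map_subtype_top, Submodule.map_bot, hN,
      ← Submodule.smul_assoc, smul_eq_mul, ← Submodule.pow_succ] at hbot

namespace PathAlgebra

variable {K V : Type u} [Field K] [Quiver.{u} V]

theorem linearMap_ext {M : Type*} [AddCommMonoid M] [Module K M] {f g : PathAlgebra K V →ₗ[K] M}
    (h : ∀ (a b : V) (p : Quiver.Path a b), f (ofPath K p) = g (ofPath K p)) : f = g := by
  ext x
  induction x using induction_on with
  | zero => rw [map_zero, map_zero]
  | add x y hx hy => rw [map_add, map_add, hx, hy]
  | smul c x hx => rw [map_smul, map_smul, hx]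
  | path a b p => exact h a b p

theorem ofPath_mem_lengthGE {a b : V} (p : Quiver.Path a b) {n : ℕ} (h : n ≤ p.length) :
    ofPath K p ∈ lengthGE K V n :=
  Submodule.subset_span ⟨a, b, p, h, rfl⟩

/-- The coefficient of the trivial path at `v`. -/
noncomputable def nilCoeff (v : V) : PathAlgebra K V →ₗ[K] K :=
  (Finsupp.lapply (⟨v, v, Quiver.Path.nil⟩ : QuiverPath V) : (QuiverPath V →₀ K) →ₗ[K] K)

theorem nilCoeff_nil_self (v : V) : nilCoeff v (ofPath K (Quiver.Path.nil : Quiver.Path v v)) = 1 :=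
  Finsupp.single_eq_same

theorem nilCoeff_ofPath_of_ne {v a b : V} (p : Quiver.Path a b) (h : a ≠ v) :
    nilCoeff v (ofPath K p) = 0 :=
  Finsupp.single_eq_of_ne fun h' => h (congrArg Sigma.fst h').symm

theorem nilCoeff_ofPath_of_length_pos {v a b : V} (p : Quiver.Path a b) (h : 0 < p.length) :
    nilCoeff v (ofPath K p) = 0 :=
  Finsupp.single_eq_of_ne fun h' =>
    h.ne (congrArg (fun q : QuiverPath V => q.2.2.length) h')

theorem nilCoeff_eq_zero_of_mem {v : V} {n : ℕ} (hn : 0 < n) {x : PathAlgebra K V}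
    (hx : x ∈ lengthGE K V n) : nilCoeff v x = 0 := by
  suffices lengthGE K V n ≤ LinearMap.ker (nilCoeff v) from this hx
  rw [lengthGE, Submodule.span_le]
  rintro _ ⟨a, b, p, hp, rfl⟩
  exact nilCoeff_ofPath_of_length_pos p (hn.trans_le hp)

theorem nilCoeff_ofPath_mul_ofPath (v : V) {a b c d : V} (q : Quiver.Path c d)
    (p : Quiver.Path a b) :
    nilCoeff v (ofPath K q * ofPath K p) = nilCoeff v (ofPath K q) * nilCoeff v (ofPath K p) := by
  rcases p.length.eq_zero_or_pos with hp | hp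
  · obtain rfl := p.eq_of_length_zero hp
    obtain rfl := p.eq_nil_of_length_zero hp
    rcases eq_or_ne c a with rfl | hca
    · rw [ofPath_mul_ofPath, Quiver.Path.nil_comp]
      rcases eq_or_ne c v with rfl | hcv
      · rw [nilCoeff_nil_self, mul_one]
      · rw [nilCoeff_ofPath_of_ne q hcv, zero_mul]
    · rw [ofPath_mul_ofPath_of_ne _ _ hca, map_zero]
      rcases eq_or_ne c v with rfl | hcv
      · rw [nilCoeff_ofPath_of_ne _ hca.symm, mul_zero]
      · rw [nilCoeff_ofPath_of_ne q hcv, zero_mul]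
  · rw [nilCoeff_ofPath_of_length_pos p hp, mul_zero]
    rcases eq_or_ne c b with rfl | hcb
    · rw [ofPath_mul_ofPath, nilCoeff_ofPath_of_length_pos]
      rw [Quiver.Path.length_comp]
      exact Nat.add_pos_left hp _
    · rw [ofPath_mul_ofPath_of_ne _ _ hcb, map_zero]

theorem finite_setOf_length_eq [Finite V] [∀ a b : V, Finite (a ⟶ b)] (n : ℕ) :
    {q : QuiverPath V | q.2.2.length = n}.Finite := by
  induction n with
  | zero =>
    refine (Set.finite_range fun v : V => (⟨v, v, Quiver.Path.nil⟩ : QuiverPath V)).subset ?_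
    rintro ⟨a, b, p⟩ hp
    obtain rfl := p.eq_of_length_zero hp
    exact ⟨a, by rw [p.eq_nil_of_length_zero hp]⟩
  | succ n ih =>
    refine (ih.biUnion fun q _ => Set.finite_range fun α : Σ c, (q.2.1 ⟶ c) =>
      (⟨q.1, α.1, q.2.2.cons α.2⟩ : QuiverPath V)).subset ?_
    rintro ⟨a, c, p⟩ hp
    cases p with
    | nil => exact absurd hp n.succ_ne_zero.symm
    | @cons b _ p α =>
      exact Set.mem_biUnion (x := (⟨a, b, p⟩ : QuiverPath V)) (Nat.succ.inj hp) ⟨⟨c, α⟩, rfl⟩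

theorem nilCoeff_mul (v : V) (x y : PathAlgebra K V) :
    nilCoeff v (x * y) = nilCoeff v x * nilCoeff v y := by
  suffices h : mulHom.compr₂ (nilCoeff v) =
      (LinearMap.mul K K).compl₁₂ (nilCoeff v) (nilCoeff v) from
    LinearMap.congr_fun (LinearMap.congr_fun h x) y
  exact linearMap_ext fun _ _ q => linearMap_ext fun _ _ p => nilCoeff_ofPath_mul_ofPath v q p

variable [Fintype V]

/-- The coefficient of the trivial path at `v` as a character of the path algebra. -/
noncomputable def counit (v : V) : PathAlgebra K V →ₐ[K] K :=
  AlgHom.ofLinearMap (nilCoeff v) (by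
    rw [one_def, map_sum, Finset.sum_eq_single v (fun w _ hw => nilCoeff_ofPath_of_ne _ hw)
      fun h => absurd (Finset.mem_univ v) h, nilCoeff_nil_self]) (nilCoeff_mul v)

theorem mem_lengthGE_one {x : PathAlgebra K V} (hx : ∀ v, counit v x = 0) :
    x ∈ lengthGE K V 1 := by
  have hmkQ : (lengthGE K V 1).mkQ = ∑ v, (nilCoeff v).smulRight
      ((lengthGE K V 1).mkQ (ofPath K (Quiver.Path.nil : Quiver.Path v v))) := by
    refine linearMap_ext fun a b p => ?_
    rw [LinearMap.sum_apply]
    simp only [LinearMap.smulRight_apply]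
    rcases p.length.eq_zero_or_pos with hp | hp
    · obtain rfl := p.eq_of_length_zero hp
      obtain rfl := p.eq_nil_of_length_zero hp
      rw [Finset.sum_eq_single a, nilCoeff_nil_self, one_smul]
      · exact fun v _ hv => by rw [nilCoeff_ofPath_of_ne _ hv.symm, zero_smul]
      · exact fun h => absurd (Finset.mem_univ a) h
    · rw [Finset.sum_eq_zero fun v _ => by rw [nilCoeff_ofPath_of_length_pos p hp, zero_smul]]
      exact (Submodule.Quotient.mk_eq_zero _).2 (ofPath_mem_lengthGE p hp)
  rw [← Submodule.Quotient.mk_eq_zero, ← Submodule.mkQ_apply, hmkQ, LinearMap.sum_apply]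
  exact Finset.sum_eq_zero fun v _ => by
    rw [LinearMap.smulRight_apply, show nilCoeff v x = 0 from hx v, zero_smul]

theorem lengthGE_mul_lengthGE_le (i j : ℕ) :
    lengthGE K V i * lengthGE K V j ≤ lengthGE K V (i + j) := by
  rw [lengthGE, lengthGE, Submodule.span_mul_span, Submodule.span_le]
  rintro _ ⟨_, ⟨b, c, q, hq, rfl⟩, _, ⟨a, b', p, hp, rfl⟩, rfl⟩
  change ofPath K q * ofPath K p ∈ lengthGE K V (i + j)
  rcases eq_or_ne b b' with rfl | hb
  · rw [ofPath_mul_ofPath]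
    refine ofPath_mem_lengthGE _ ?_
    rw [Quiver.Path.length_comp, add_comm]
    exact add_le_add hp hq
  · rw [ofPath_mul_ofPath_of_ne _ _ hb]
    exact zero_mem _

theorem pow_mem_lengthGE {x : PathAlgebra K V} (hx : x ∈ lengthGE K V 1) (n : ℕ) :
    x ^ n ∈ lengthGE K V n := by
  induction n with
  | zero =>
    rw [pow_zero, one_def]
    exact sum_mem fun v _ => ofPath_mem_lengthGE _ (Nat.zero_le _)
  | succ n ih =>
    rw [pow_succ]
    exact lengthGE_mul_lengthGE_le n 1 (Submodule.mul_mem_mul ih hx)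

section Quotient

variable (I : Ideal (PathAlgebra K V)) [I.IsTwoSided]

theorem pathClass_mul_pathClass {a b c : V} (q : Quiver.Path b c) (p : Quiver.Path a b) :
    pathClass I q * pathClass I p = pathClass I (p.comp q) := by
  rw [pathClass, pathClass, ← map_mul, ofPath_mul_ofPath]
  rfl

theorem pathClass_mul_pathClass_of_ne {a b c d : V} (q : Quiver.Path c d) (p : Quiver.Path a b)
    (h : c ≠ b) : pathClass I q * pathClass I p = 0 := by
  rw [pathClass, pathClass, ← map_mul, ofPath_mul_ofPath_of_ne _ _ h, map_zero]

theorem pathClass_mul_nil {a b : V} (p : Quiver.Path a b) :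
    pathClass I p * pathClass I (Quiver.Path.nil : Quiver.Path a a) = pathClass I p := by
  rw [pathClass_mul_pathClass, Quiver.Path.nil_comp]

theorem nil_mul_pathClass {a b : V} (p : Quiver.Path a b) :
    pathClass I (Quiver.Path.nil : Quiver.Path b b) * pathClass I p = pathClass I p := by
  rw [pathClass_mul_pathClass, Quiver.Path.comp_nil]

theorem pathClass_mem_span_toPath {a c d : V} [Subsingleton (Σ c : V, a ⟶ c)] (β : a ⟶ d)
    (q : Quiver.Path a c) (hq : 0 < q.length) :
    pathClass I q ∈ Submodule.span (PathAlgebra K V ⧸ I) {pathClass I β.toPath} := by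
  obtain ⟨d', α, q', -, rfl⟩ := q.eq_toPath_comp_of_length_eq_succ (Nat.sub_add_cancel hq).symm
  rw [← pathClass_mul_pathClass]
  obtain ⟨rfl, hα⟩ := Sigma.mk.inj_iff.1 (Subsingleton.elim (⟨d', α⟩ : Σ c : V, a ⟶ c) ⟨d, β⟩)
  obtain rfl := eq_of_heq hα
  exact Submodule.smul_mem _ _ (Submodule.mem_span_singleton_self _)

variable {I} (hI : IsAdmissible I)

/-- The character of `KΓ/I` at the vertex `v`. -/
noncomputable def quotientCounit (v : V) : (PathAlgebra K V ⧸ I) →ₐ[K] K :=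
  Ideal.Quotient.liftₐ I (counit v) fun x hx => nilCoeff_eq_zero_of_mem two_pos (hI.1 x hx)

theorem isSplitBasic :
    IsSplitBasic (fun v => pathClass I (Quiver.Path.nil : Quiver.Path v v))
      (quotientCounit hI) where
  isIdempotentElem v := pathClass_mul_nil I _
  sum_eq_one := by
    simp only [pathClass]
    rw [← map_sum, ← one_def, map_one]
  apply_self v := nilCoeff_nil_self v
  apply_of_ne v w h := nilCoeff_ofPath_of_ne _ h.symm
  isNilpotent r hr := by
    obtain ⟨x, rfl⟩ := Ideal.Quotient.mk_surjective r
    obtain ⟨N, hN⟩ := hI.2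
    refine ⟨N, ?_⟩
    rw [← map_pow]
    exact Ideal.Quotient.eq_zero_iff_mem.2 (hN _ (pow_mem_lengthGE (mem_lengthGE_one hr) N))

include hI

theorem finite_quotient [∀ a b : V, Finite (a ⟶ b)] : Module.Finite K (PathAlgebra K V ⧸ I) := by
  obtain ⟨N, hN⟩ := hI.2
  have hfin : {q : QuiverPath V | q.2.2.length < N}.Finite :=
    ((Set.finite_lt_nat N).biUnion fun n _ => finite_setOf_length_eq (V := V) n).subset
      fun q hq => Set.mem_biUnion (x := q.2.2.length) hq rfl
  let S := Submodule.span K ((fun q : QuiverPath V => pathClass I q.2.2) '' {q | q.2.2.length < N})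
  have hS : S.mkQ ∘ₗ (Ideal.Quotient.mkₐ K I).toLinearMap = 0 :=
    linearMap_ext fun a b p => (Submodule.Quotient.mk_eq_zero S).2 (by
      rcases lt_or_ge p.length N with hp | hp
      · exact Submodule.subset_span ⟨⟨a, b, p⟩, hp, rfl⟩
      · have h0 : pathClass I p = 0 :=
          Ideal.Quotient.eq_zero_iff_mem.2 (hN _ (ofPath_mem_lengthGE p hp))
        exact (congrArg (· ∈ S) h0).mpr (zero_mem S))
  refine ⟨Submodule.fg_def.2 ⟨_, hfin.image fun q => pathClass I q.2.2, eq_top_iff.2 fun r _ => ?_⟩⟩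
  obtain ⟨x, rfl⟩ := Ideal.Quotient.mk_surjective r
  exact (Submodule.Quotient.mk_eq_zero S).1 (LinearMap.congr_fun hS x)

theorem pathClass_mem_jacobson {a b : V} (p : Quiver.Path a b) (hp : 0 < p.length) :
    pathClass I p ∈ Ring.jacobson (PathAlgebra K V ⧸ I) :=
  (isSplitBasic hI).mem_jacobson.2 fun _ => nilCoeff_ofPath_of_length_pos p hp

theorem radicalMul_eq_span {a : V} (h : Nat.card (Σ c : V, a ⟶ c) = 1) :
    ∃ (d : V) (β : a ⟶ d), radicalMul (PathAlgebra K V ⧸ I)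
      (pathClass I (Quiver.Path.nil : Quiver.Path a a)) =
        Submodule.span (PathAlgebra K V ⧸ I) {pathClass I β.toPath} := by
  obtain ⟨_, ⟨⟨d, β⟩⟩⟩ := Nat.card_eq_one_iff_unique.1 h
  set S := Submodule.span (PathAlgebra K V ⧸ I) {pathClass I β.toPath}
  refine ⟨d, β, le_antisymm (fun r hr => ?_) ?_⟩
  · obtain ⟨j, hj, rfl⟩ := mem_radicalMul.1 hr
    obtain ⟨x, rfl⟩ := Ideal.Quotient.mk_surjective j
    suffices lengthGE K V 1 ≤ (S.restrictScalars K).comap (LinearMap.mulRight K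
        (pathClass I (Quiver.Path.nil : Quiver.Path a a)) ∘ₗ (Ideal.Quotient.mkₐ K I).toLinearMap)
      from this (mem_lengthGE_one ((isSplitBasic hI).mem_jacobson.1 hj))
    rw [lengthGE, Submodule.span_le]
    rintro _ ⟨b, c, q, hq, rfl⟩
    change pathClass I q * pathClass I Quiver.Path.nil ∈ S
    rcases eq_or_ne b a with rfl | hba
    · rw [pathClass_mul_nil]
      exact pathClass_mem_span_toPath I β q hq
    · rw [pathClass_mul_pathClass_of_ne I _ _ hba]
      exact zero_mem S
  · rw [Submodule.span_singleton_le_iff_mem]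
    exact mem_radicalMul.2 ⟨_, pathClass_mem_jacobson hI β.toPath Nat.one_pos,
      pathClass_mul_nil I _⟩

theorem pathClass_mem_jacobson_pow {a b : V} (p : Quiver.Path a b) :
    pathClass I p ∈ Ring.jacobson (PathAlgebra K V ⧸ I) ^ p.length := by
  induction p with
  | nil =>
    rw [Quiver.Path.length_nil, Submodule.pow_zero, Ideal.one_eq_top]
    exact Submodule.mem_top
  | cons p α ih =>
    rw [← Quiver.Path.comp_toPath_eq_cons, ← pathClass_mul_pathClass, Quiver.Path.length_comp,
      Quiver.Path.length_toPath, Ideal.IsTwoSided.pow_succ]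
    exact Ideal.mul_mem_mul (pathClass_mem_jacobson hI α.toPath Nat.one_pos) ih

end Quotient

end PathAlgebra

namespace IsMast

variable {K V : Type u} [Field K] [Quiver.{u} V] [Fintype V] {I : Ideal (PathAlgebra K V)}
  [I.IsTwoSided] {a b : V} {p : Quiver.Path a b} {U : Type u} [AddCommGroup U]
  [Module (PathAlgebra K V ⧸ I) U] (hp : IsMast I p U) (hI : PathAlgebra.IsAdmissible I)

include hp hI

theorem pathClass_smul_eq_zero {y : U} (hy : y ∈ Ring.jacobson (PathAlgebra K V ⧸ I) •
    (⊤ : Submodule (PathAlgebra K V ⧸ I) U)) : PathAlgebra.pathClass I p • y = 0 := by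
  have hmem := Submodule.smul_mem_smul (PathAlgebra.pathClass_mem_jacobson_pow hI p) hy
  rwa [← Submodule.smul_assoc, smul_eq_mul, ← Submodule.pow_succ,
    jacobson_pow_smul_eq_bot hp.1.le, Submodule.mem_bot] at hmem

theorem exists_span_eq_top
    (hU : ∀ N N' : Submodule (PathAlgebra K V ⧸ I) U, N ≤ N' ∨ N' ≤ N) :
    ∃ x : U, PathAlgebra.pathClass I (Quiver.Path.nil : Quiver.Path a a) • x = x ∧
      PathAlgebra.pathClass I p • x ≠ 0 ∧ Submodule.span (PathAlgebra K V ⧸ I) {x} = ⊤ := by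
  obtain ⟨x, hx⟩ := hp.2
  rw [← PathAlgebra.pathClass_mul_nil, mul_smul] at hx
  refine ⟨_, ?_, hx, (PathAlgebra.isSplitBasic hI).span_eq_top_of_notMem hU fun hmem =>
    hx (hp.pathClass_smul_eq_zero hI hmem)⟩
  rw [← mul_smul, PathAlgebra.pathClass_mul_nil]

end IsMast

theorem iSup_fin_two {α : Type*} [CompleteLattice α] (f : Fin 2 → α) : ⨆ i, f i = f 0 ⊔ f 1 :=
  le_antisymm (iSup_le (Fin.forall_fin_two.2 ⟨le_sup_left, le_sup_right⟩))
    (sup_le (le_iSup f 0) (le_iSup f 1))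

theorem mainTheorem12_general {K V : Type u} [Field K] [Quiver.{u} V] [Fintype V]
    [∀ a b : V, Finite (a ⟶ b)]
    (I : Ideal (PathAlgebra K V)) [I.IsTwoSided] (hI : PathAlgebra.IsAdmissible I)
    (U : Type u) [AddCommGroup U] [Module (PathAlgebra K V ⧸ I) U]
    (hU : IsUniserial (PathAlgebra K V ⧸ I) U)
    (hproj : ¬ Module.Projective (PathAlgebra K V ⧸ I) U)
    {a b : V} (p : Quiver.Path a b) (hp : IsMast I p U)
    (m : ℕ) (hm : ∃ W : Fin m → Submodule (PathAlgebra K V ⧸ I) (PathAlgebra K V ⧸ I),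
      (∀ i, IsUniserial (PathAlgebra K V ⧸ I) (W i)) ∧ radicalMul (PathAlgebra K V ⧸ I)
        (PathAlgebra.pathClass I (Quiver.Path.nil : Quiver.Path a a)) = ⨆ i, W i) :
    (m = 1 → AlphaLE (PathAlgebra K V ⧸ I) U 2) ∧
    (Nat.card (Σ c : V, a ⟶ c) = 1 → AlphaLE (PathAlgebra K V ⧸ I) U 2) ∧
    (m = 2 → (∀ j ∈ Ring.jacobson (PathAlgebra K V ⧸ I), j * PathAlgebra.pathClass I p = 0) →
      AlphaEq (PathAlgebra K V ⧸ I) U 1) := by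
  have hs := PathAlgebra.isSplitBasic hI
  have : Module.Finite K (PathAlgebra K V ⧸ I) := PathAlgebra.finite_quotient hI
  have : IsNoetherianRing (PathAlgebra K V ⧸ I) := IsNoetherianRing.of_finite K _
  have : IsNoetherian (PathAlgebra K V ⧸ I) U :=
    (isFiniteLength_iff_isNoetherian_isArtinian.1 hU.1).1
  obtain ⟨x, hxa, hpx, hspan⟩ := hp.exists_span_eq_top hI hU.2
  obtain ⟨W, hW, hWsup⟩ := hm
  refine ⟨?_, fun hcard => ?_, ?_⟩
  · rintro rfl
    rw [ciSup_unique] at hWsup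
    obtain ⟨c, ω, h⟩ := hs.exists_isOneRelation_of_chain hxa hspan hproj
      (hWsup ▸ (le_total_coe_iff _).1 (hW default).2)
    exact h.alphaLE_two hs hU.2
  · obtain ⟨d, β, hβ⟩ := PathAlgebra.radicalMul_eq_span hI hcard
    obtain ⟨c, ω, h⟩ := hs.exists_isOneRelation_of_chain hxa hspan hproj (hβ ▸
      hs.le_total_of_span_eq_iSup (v := d) (PathAlgebra.nil_mul_pathClass I β.toPath)
        (fun i => (hW i).2) (hβ.symm.trans hWsup))
    exact h.alphaLE_two hs hU.2
  · rintro rfl hJp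
    have hbp := PathAlgebra.nil_mul_pathClass I p
    have hpJ := hs.mem_radicalMul_of_jacobson_mul_eq_zero (PathAlgebra.pathClass_mul_nil I p) hJp
      (hs.radicalMul_ne_bot hxa hspan hproj)
    obtain ⟨c, ω, h⟩ := hs.exists_isOneRelation_of_sup hxa hspan hproj hU.2 (hW 0).2 (hW 1).2
      (hWsup.trans (iSup_fin_two W)) hbp hpJ hpx hJp
    exact h.alphaEq_one hs hU.2 (h.not_isIrreducibleHom_subtype hs hbp hpJ hpx hJp
      fun y => hp.pathClass_smul_eq_zero hI)

theorem mainTheorem12 {K V : Type u} [Field K] [Quiver.{u} V] [Fintype V]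
    [∀ a b : V, Finite (a ⟶ b)]
    (I : Ideal (PathAlgebra K V)) [I.IsTwoSided] (hI : PathAlgebra.IsAdmissible I)
    (m : ℕ) (hm : IsLeftMultiserial (PathAlgebra K V ⧸ I) m)
    (U : Type u) [AddCommGroup U] [Module (PathAlgebra K V ⧸ I) U]
    (hU : IsUniserial (PathAlgebra K V ⧸ I) U)
    (hproj : ¬ Module.Projective (PathAlgebra K V ⧸ I) U)
    {a b : V} (p : Quiver.Path a b) (hp : IsMast I p U) :
    (m = 1 → AlphaLE (PathAlgebra K V ⧸ I) U 2) ∧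
    (Nat.card (Σ c : V, a ⟶ c) = 1 → AlphaLE (PathAlgebra K V ⧸ I) U 2) ∧
    (m = 2 → (∀ j ∈ Ring.jacobson (PathAlgebra K V ⧸ I), j * PathAlgebra.pathClass I p = 0) →
      AlphaEq (PathAlgebra K V ⧸ I) U 1) :=
  mainTheorem12_general I hI U hU hproj p hp m
    (hm _ ((PathAlgebra.isSplitBasic hI).isPrimitiveIdempotent a))
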